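/- Let $s\ge 0$ and $N,m\ge 1$ be integers, and put $n=N^s$. Let $P(2s,2s)$ be the set of partitions of an upper row of $2s$ points and a lower row of $2s$ points, and let $P_{even}(2s,2s)$ be the set of those having all blocks of even size. For $\pi\in P(2s,2s)$ and multi-indices $a,b,c,d\in\{1,\ldots,N\}^s$, let $\delta_\pi\begin{pmatrix}a&c\\ b&d\end{pmatrix}$ be $1$ if, after writing $a,c$ on the left and right half of the upper row and $b,d$ on the left and right half of the lower row, each block of $\pi$ contains equal indices, and $0$ otherwise. Index $M_n(\mathbb C)$ by multi-indices and let $\varphi_\pi:M_n(\mathbb C)\to M_n(\mathbb C)$ be the linear map $$\varphi_\pi(e_{a,c})=\sum_{b,d}\delta_\pi\begin{pmatrix}a&c\\ b&d\end{pmatrix}e_{b,d}.$$ Let $\Lambda_\pi\in M_n(\mathbb C)\otimes M_n(\mathbb C)$ be the matrix with entries $(\Lambda_\pi)_{ab,cd}=\varphi_\pi(e_{a,c})_{b,d}$. Let $\pi^\circ$ be obtained from $\pi$ by exchanging the left and right halves of both rows, and $\pi^*$ by exchanging the upper and lower rows. A linear map $\varphi:M_n(\mathbb C)\to M_n(\mathbb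 C)$ is unital modulo scalars if $\varphi(1)=c1$ for some $c\in\mathbb C$. For a finite positive measure $\mu$ on $\mathbb C$ with bounded support and mass $c>0$, the compound free Poisson law $\pi_\mu$ is the $*$-distribution $$\pi_\mu=\lim_{k\to\infty}\left(\left(1-\frac ck\right)\delta_0+\frac1k\mu\right)^{\boxplus k},$$ the limit being taken in $*$-moments, where $\boxplus$ is the free additive convolution, that is, the operation on $*$-distributions under which free $*$-cumulants add up. The free $*$-cumulants $\kappa$ of a $*$-distribution with $*$-moments $M$ are defined by $M(e_1,\ldots,e_p)=\sum_{\sigma\in NC(p)}\prod_{V\in\sigma}\kappa(e|_V)$ for all $p\geq1$ and $e_1,\ldots,e_p\in\{1,*\}$, the sum being over the noncrossing partitions of $\{1,\ldots,p\}$. **Theorem.** Let $\pi\in P_{even}(2s,2s)$ be symmetric, $\pi=\pi^\circ$, and assume that $\varphi_\pi$ and $\varphi_{\pi^*}$ are both unital modulo scalars. For each $d$ let $G$ be a $dn\times dm$ random matrix with independent standard complex Gaussian entries ($\mathbb E|G_{ij}|^2=1$), let $W=\frac1{dm}GG^*$ be the corresponding Wishart matrix, viewed as a $d\times d$ array of $n\times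 n$ blocks, and let $\tilde W=(id\otimes\varphi_\pi)W$ be obtained by applying $\varphi_\pi$ to each block. Then there is a probability measure $\rho=law(\Lambda_\pi)$ on $\mathbb C$, with bounded support, having the same $*$-moments as $\Lambda_\pi$ with respect to the normalized trace, the compound free Poisson law $\pi_{mn\rho}$ exists, and $$m\tilde W\sim\pi_{mn\rho}$$ in $*$-moments as $d\to\infty$, with $m,n$ fixed: for any $p\ge 0$ and any $e_1,\ldots,e_p\in\{1,*\}$, the random variable $tr\big((m\tilde W)^{e_1}\cdots(m\tilde W)^{e_p}\big)$, with $tr$ the normalized trace, is integrable for every $d$, and its expectation converges, as $d\to\infty$, to the corresponding $*$-moment of $\pi_{mn\rho}$. -/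

import Mathlib

open MeasureTheory ProbabilityTheory Filter Topology
open scoped ENNReal NNReal

noncomputable section

/-! ## Exponents, `*`-words, `*`-distributions -/

/-- The exponents `1` and `*`. -/
inductive StarExp
  | one
  | star

/-- `x ^ 1 = x` and `x ^ * = star x`. -/
def starPow {A : Type*} [Star A] (x : A) : StarExp → A
  | .one => x
  | .star => star x

/-- The `*`-word `x ^ e₁ ⋯ x ^ eₚ`. -/
def starWord {A : Type*} [Monoid A] [Star A] (x : A) {p : ℕ} (e : Fin p → StarExp) : A :=
  (List.ofFn fun i => starPow (A := A) x (e i)).prod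

/-- A `*`-distribution, encoded by its `*`-moments: the values on the `*`-words of every length
`p` of a linear functional on the noncommutative polynomials in `z, z*`. -/
abbrev StarDistribution : Type := (p : ℕ) → (Fin p → StarExp) → ℂ

/-- The normalized trace. -/
def ntrace {ι : Type*} [Fintype ι] (A : Matrix ι ι ℂ) : ℂ :=
  (Fintype.card ι : ℂ)⁻¹ * A.trace

/-- The `*`-moments of a deterministic matrix, with respect to the normalized trace. -/
def matrixStarMoments {ι : Type*} [Fintype ι] [DecidableEq ι] (A : Matrix ι ι ℂ) :
    StarDistribution :=
  fun _ e => ntrace (starWord A e)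

/-- The `*`-moments `(𝔼 ∘ tr) (X ^ e₁ ⋯ X ^ eₚ)` of a random matrix. -/
def randomMatrixStarMoments {Ω : Type*} [MeasurableSpace Ω] (P : Measure Ω)
    {ι : Type*} [Fintype ι] [DecidableEq ι] (X : Ω → Matrix ι ι ℂ) : StarDistribution :=
  fun _ e => ∫ ω, ntrace (starWord (X ω) e) ∂P

/-- The `*`-moments of a measure on `ℂ`: the integrals of the words in `z` and its conjugate. -/
def measureStarMoments (μ : Measure ℂ) : StarDistribution :=
  fun _ e => ∫ z, starWord z e ∂μ

/-- `ρ = law(A)`: the probability measure `ρ` on `ℂ`, with bounded support, has the same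
`*`-moments as the matrix `A`. There is at most one such `ρ`. -/
structure IsLaw {ι : Type*} [Fintype ι] [DecidableEq ι] (A : Matrix ι ι ℂ) (ρ : Measure ℂ) :
    Prop where
  isProbabilityMeasure : IsProbabilityMeasure ρ
  bounded_support : ∃ R : ℝ, ∀ᵐ z ∂ρ, ‖z‖ ≤ R
  moments_eq : measureStarMoments ρ = matrixStarMoments A

/-! ## Free cumulants, free convolution, compound free Poisson laws -/

/-- Noncrossing partitions of `{0, …, p - 1}`: there are no `a < b < c < d` with `a, c` in one
block and `b, d` in another one. -/
def IsNoncrossing {p : ℕ} (σ : Finpartition (Finset.univ : Finset (Fin p))) : Prop :=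
  ∀ B ∈ σ.parts, ∀ C ∈ σ.parts, ∀ a b c d : Fin p, a < b → b < c → c < d →
    a ∈ B → c ∈ B → b ∈ C → d ∈ C → B = C

open Classical in
/-- The set `NC(p)` of noncrossing partitions. -/
def noncrossingPartitions (p : ℕ) : Finset (Finpartition (Finset.univ : Finset (Fin p))) :=
  Finset.univ.filter IsNoncrossing

/-- The subword of `e` with positions in `V`, in increasing order. -/
def subword {p : ℕ} (e : Fin p → StarExp) (V : Finset (Fin p)) : Fin V.card → StarExp :=
  fun i => e (V.orderEmbOfFin rfl i)

/-- The moment-cumulant formula: the `*`-moments `∑_{σ ∈ NC(p)} ∏_{V ∈ σ} κ(e|_V)` of the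
`*`-distribution with free `*`-cumulants `κ`. -/
def momentsOfCumulants (κ : StarDistribution) : StarDistribution :=
  fun p e => ∑ σ ∈ noncrossingPartitions p, ∏ V ∈ σ.parts, κ V.card (subword e V)

open Classical in
/-- The free `*`-cumulants of a `*`-distribution, obtained by solving the moment-cumulant formula
recursively for the term of the one-block partition. (Only the cumulants of order `p ≥ 1` are
meaningful, and only these are ever used.) -/
def freeCumulants (M : StarDistribution) : (p : ℕ) → (Fin p → StarExp) → ℂ
  | p, e => M p e -
      ∑ σ : {σ : Finpartition (Finset.univ : Finset (Fin p)) //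
          IsNoncrossing σ ∧ Finset.univ ∉ σ.parts},
        ∏ V : {V // V ∈ σ.1.parts}, freeCumulants M V.1.card (subword e V.1)
termination_by p => p
decreasing_by
  have hV : V.1 ≠ Finset.univ := fun h => σ.2.2 (by have := V.2; rwa [h] at this)
  simpa using Finset.card_lt_univ_of_notMem
    (not_forall.mp fun h => hV (Finset.eq_univ_iff_forall.mpr h)).choose_spec

/-- The free cumulants do solve the moment-cumulant formula. -/
theorem momentsOfCumulants_freeCumulants (M : StarDistribution) {p : ℕ} (hp : p ≠ 0)
    (e : Fin p → StarExp) : momentsOfCumulants (freeCumulants M) p e = M p e := by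
  classical
  have hcast : ∀ (κ : StarDistribution) (q : ℕ) (h : q = p),
      κ q (fun i => e (Fin.cast h i)) = κ p e := by
    rintro κ q rfl
    rfl
  have huniv : ∀ κ : StarDistribution,
      κ (Finset.univ : Finset (Fin p)).card (subword e Finset.univ) = κ p e := by
    intro κ
    rw [← hcast κ _ (Finset.card_fin p)]
    congr 1
    funext i
    have := Finset.orderEmbOfFin_unique (s := (Finset.univ : Finset (Fin p))) rfl
      (f := fun i => Fin.cast (Finset.card_fin p) i) (fun _ => Finset.mem_univ _)
      (fun _ _ h => h)
    simp only [subword]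
    rw [← this]
  have hne : (Finset.univ : Finset (Fin p)) ≠ ⊥ := by
    have : NeZero p := ⟨hp⟩
    exact Finset.univ_nonempty.ne_empty
  have hparts : ∀ σ : Finpartition (Finset.univ : Finset (Fin p)),
      Finset.univ ∈ σ.parts ↔ σ = Finpartition.indiscrete hne := by
    intro σ
    constructor
    · intro h
      ext V
      simp only [Finpartition.indiscrete_parts, Finset.mem_singleton]
      refine ⟨fun hV => ?_, fun hV => hV ▸ h⟩
      by_contra hVn
      have hd : Disjoint V Finset.univ := σ.disjoint hV h hVn
      exact σ.ne_bot hV (disjoint_top.mp hd)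
    · rintro rfl
      simp
  have hmem : Finpartition.indiscrete hne ∈ noncrossingPartitions p := by
    simp only [noncrossingPartitions, Finset.mem_filter, Finset.mem_univ, true_and]
    intro B hB C hC
    simp only [Finpartition.indiscrete_parts, Finset.mem_singleton] at hB hC
    simp [hB, hC]
  rw [momentsOfCumulants, ← Finset.add_sum_erase _ _ hmem, Finpartition.indiscrete_parts,
    Finset.prod_singleton, huniv (freeCumulants M), freeCumulants]
  have hsum : ∑ σ ∈ (noncrossingPartitions p).erase (Finpartition.indiscrete hne),
      ∏ V ∈ σ.parts, freeCumulants M V.card (subword e V) =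
      ∑ σ : {σ : Finpartition (Finset.univ : Finset (Fin p)) //
          IsNoncrossing σ ∧ Finset.univ ∉ σ.parts},
        ∏ V : {V // V ∈ σ.1.parts}, freeCumulants M V.1.card (subword e V.1) := by
    rw [Finset.sum_subtype (p := fun σ : Finpartition (Finset.univ : Finset (Fin p)) =>
      IsNoncrossing σ ∧ Finset.univ ∉ σ.parts)]
    · refine Finset.sum_congr rfl fun σ _ => ?_
      rw [← Finset.prod_coe_sort]
    · intro σ
      simp [noncrossingPartitions, hparts, and_comm]
  rw [hsum]
  ring

/-- The free additive convolution `M₁ ⊞ M₂`: the free cumulants add up. -/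
def freeConv (M₁ M₂ : StarDistribution) : StarDistribution :=
  momentsOfCumulants (freeCumulants M₁ + freeCumulants M₂)

/-- The free convolution powers `M ^ {⊞ k}`, with `M ^ {⊞ 0}` being the law of `0`. -/
def freeConvPow (M : StarDistribution) : ℕ → StarDistribution
  | 0 => measureStarMoments (Measure.dirac 0)
  | k + 1 => freeConv (freeConvPow M k) M

/-- The measure `(1 - c / k) δ₀ + (1 / k) μ`, where `c` is the mass of `μ`. -/
def poissonStep (μ : Measure ℂ) (k : ℕ) : Measure ℂ :=
  ENNReal.ofReal (1 - μ.real Set.univ / k) • Measure.dirac 0 + (k : ℝ≥0∞)⁻¹ • μ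

/-- `L` is the compound free Poisson law `π_μ`, that is,
`π_μ = lim_{k → ∞} ((1 - c / k) δ₀ + (1 / k) μ) ^ {⊞ k}`, the limit being in `*`-moments. -/
def IsCompoundFreePoisson (μ : Measure ℂ) (L : StarDistribution) : Prop :=
  ∀ (p : ℕ) (e : Fin p → StarExp),
    Tendsto (fun k : ℕ => freeConvPow (measureStarMoments (poissonStep μ k)) k p e)
      atTop (𝓝 (L p e))

/-! ## Wishart matrices and block modifications -/

/-- The standard complex Gaussian law `N(0, 1)`: real and imaginary parts are independent real
centered Gaussians of variance `1 / 2`. -/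
def stdComplexGaussian : Measure ℂ :=
  ((gaussianReal 0 (1 / 2)).prod (gaussianReal 0 (1 / 2))).map
    fun x : ℝ × ℝ => (⟨x.1, x.2⟩ : ℂ)

/-- A random matrix with independent standard complex Gaussian entries. -/
structure IsComplexGaussianMatrix {Ω : Type*} [MeasurableSpace Ω] (P : Measure Ω)
    {ι κ : Type*} (G : Ω → Matrix ι κ ℂ) : Prop where
  hasLaw : ∀ i j, HasLaw (fun ω => G ω i j) stdComplexGaussian P
  indep : iIndepFun (fun (x : ι × κ) ω => G ω x.1 x.2) P

/-- The Wishart matrix `W = (1 / dm) G G*` associated to a `dn × dm` matrix `G`, with the rows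
indexed by `{1, …, d} × κ`, where `κ` has `n` elements. -/
def wishart {κ : Type*} {d m : ℕ} (G : Matrix (Fin d × κ) (Fin d × Fin m) ℂ) :
    Matrix (Fin d × κ) (Fin d × κ) ℂ :=
  ((d : ℂ) * (m : ℂ))⁻¹ • (G * G.conjTranspose)

/-- `(id ⊗ φ) A`: the map `φ` is applied to each of the blocks of `A`. -/
def blockModify {ι κ : Type*} (φ : Matrix κ κ ℂ →ₗ[ℂ] Matrix κ κ ℂ)
    (A : Matrix (ι × κ) (ι × κ) ℂ) : Matrix (ι × κ) (ι × κ) ℂ :=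
  Matrix.of fun x y => φ (Matrix.of fun c d => A (x.1, c) (y.1, d)) x.2 y.2

theorem blockModify_kronecker {ι κ : Type*} (φ : Matrix κ κ ℂ →ₗ[ℂ] Matrix κ κ ℂ)
    (A : Matrix ι ι ℂ) (B : Matrix κ κ ℂ) :
    blockModify φ (Matrix.kronecker A B) = Matrix.kronecker A (φ B) := by
  ext x y
  have h : (Matrix.of fun c d => (Matrix.kronecker A B) (x.1, c) (y.1, d)) = A x.1 y.1 • B := by
    ext c d
    simp [Matrix.kronecker, Matrix.kroneckerMap]
  rw [blockModify, Matrix.of_apply, h]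
  simp [Matrix.kronecker, Matrix.kroneckerMap]

/-- The square matrix `Λ_{ab,cd} = φ(e_{ac})_{bd}` associated to a linear map `φ`. -/
def choiMatrix {κ : Type*} [DecidableEq κ] (φ : Matrix κ κ ℂ →ₗ[ℂ] Matrix κ κ ℂ) :
    Matrix (κ × κ) (κ × κ) ℂ :=
  Matrix.of fun x y => φ (Matrix.single x.1 y.1 1) x.2 y.2

/-- `φ` is unital modulo scalars: `φ(1) = c 1`, with `c ∈ ℂ`. -/
def IsUnitalModScalars {κ : Type*} [DecidableEq κ] (φ : Matrix κ κ ℂ →ₗ[ℂ] Matrix κ κ ℂ) : Prop :=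
  ∃ c : ℂ, φ 1 = c • (1 : Matrix κ κ ℂ)

/-! ## Partitions and easy maps -/

/-- The partitions `P(2s, 2s)`, as equivalence relations on the set of points. The first summand
is the upper row and the second summand is the lower row; in each row, the first summand is the
left half, consisting of `s` points, and the second summand is the right half. -/
abbrev RowPartition (s : ℕ) : Type := Setoid ((Fin s ⊕ Fin s) ⊕ (Fin s ⊕ Fin s))

namespace RowPartition

variable {s : ℕ}

/-- `π ∈ P_even(2s, 2s)`: all the blocks of `π` have even size. -/
def IsEven (π : RowPartition s) : Prop := ∀ B ∈ π.classes, Even B.ncard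

/-- The blockwise middle symmetry `π ↦ π°`, exchanging the left and the right half of each row. -/
abbrev middleFlip (π : RowPartition s) : RowPartition s :=
  π.comap (Sum.map Sum.swap Sum.swap)

/-- The upside-down turning `π ↦ π*`, exchanging the upper and the lower row. -/
abbrev upsideDown (π : RowPartition s) : RowPartition s := π.comap Sum.swap

open Classical in
/-- The Kronecker symbol `δ_π (a c / b d)`, for multi-indices `a, c` on the halves of the upper row
and `b, d` on the halves of the lower row: it is `1` when each block of `π` contains equal
indices, and `0` otherwise. -/
def delta (π : RowPartition s) {N : ℕ} (a c b d : Fin s → Fin N) : ℂ :=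
  if ∀ x y, π x y →
      Sum.elim (Sum.elim a c) (Sum.elim b d) x = Sum.elim (Sum.elim a c) (Sum.elim b d) y
  then 1 else 0

/-- The easy map `φ_π : M_n(ℂ) → M_n(ℂ)`, `n = N ^ s`, the matrices being indexed by multi-indices
in `{1, …, N} ^ s`; it is given by `φ_π (e_{a,c}) = ∑_{b,d} δ_π (a c / b d) e_{b,d}`. -/
def easyMap (N : ℕ) (π : RowPartition s) :
    Matrix (Fin s → Fin N) (Fin s → Fin N) ℂ →ₗ[ℂ] Matrix (Fin s → Fin N) (Fin s → Fin N) ℂ where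
  toFun A := Matrix.of fun b d => ∑ a, ∑ c, A a c * π.delta a c b d
  map_add' A B := by ext; simp [add_mul, Finset.sum_add_distrib]
  map_smul' z A := by ext; simp [mul_assoc, Finset.mul_sum]

theorem easyMap_single (N : ℕ) (π : RowPartition s) (a c : Fin s → Fin N) :
    π.easyMap N (Matrix.single a c 1) =
      ∑ b, ∑ d, π.delta a c b d • Matrix.single b d (1 : ℂ) := by
  ext b d
  simp [easyMap, Matrix.single, Matrix.sum_apply, ite_and]

end RowPartition

end

/-! The symmetry `π = π°` makes `Λ = Λ_π`, and hence `mW̃`, Hermitian. So every `*`-word is a power,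
`ρ` is the eigenvalue distribution of `Λ`, and only the traces of powers have to be computed.

Let `β` be the cyclic rotation of `p` points. Expanding `tr (mW̃)^p` into cyclic products and
applying Wick's formula (`integral_prod_gaussian`) gives a sum over permutations `α` of the `p`
factors. The index constraints separate (`sum_gaussian_pairing`): `α` contributes `d ^
(#orbits(βα⁻¹) + #orbits(α) - p - 1)`, times `m ^ #orbits(α)`, times `n⁻¹` times a trace of `Λ^{⊗p}`
whose legs are twisted by `α` and `β`.

The exponent of `d` is handled by a reduction instead of Euler characteristics. A point fixed by
`α`, or a point `u` with `α⁻¹ u = β⁻¹ u`, can be removed from the pair `(α, β)` with a controlled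
effect on all the counts. If `α` is planar, the reduction runs down to one point
(`IsPlanar.isReducible`) and the exponent is `0`. Otherwise it gets stuck at a pair where neither
`α` nor `βα⁻¹` has a fixed point left, and a crude orbit count makes the exponent negative
(`agreeCount_mul_pow_le_of_not_isPlanar`).

The same reduction evaluates the twisted trace for planar `α` (`IsReducible.twistedTrace_eq`),
provided that the partial traces of all powers of `Λ` are scalars. This is where unitality and
evenness enter (`hasScalarPartialTraces_choiMatrix`): unitality attaches each point of `π` to at
most one lower leg, so permuting or changing the sign of index values leg by leg gives symmetries of
`Λ`.

Planar permutations correspond to noncrossing partitions (`sum_isPlanar_eq_sum_noncrossing`), so the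
limit is a sum over `NC(p)` of products of `mn tr(Λ^|V|)`. The limiting free cumulants are thus the
moments of `mnρ`, which are the free cumulants of the compound free Poisson law
(`isCompoundFreePoisson_momentsOfCumulants`). -/

/-! ### Moments of the standard complex Gaussian law -/

theorem measurable_complex_mk : Measurable fun x : ℝ × ℝ => (⟨x.1, x.2⟩ : ℂ) := by
  have hfun : (fun x : ℝ × ℝ => (⟨x.1, x.2⟩ : ℂ)) = Complex.measurableEquivRealProd.symm :=
    funext fun x => Complex.ext (by simp) (by simp)
  rw [hfun]
  exact MeasurableEquiv.measurable _

instance isProbabilityMeasure_stdComplexGaussian : IsProbabilityMeasure stdComplexGaussian :=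
  Measure.isProbabilityMeasure_map measurable_complex_mk.aemeasurable

theorem stdComplexGaussian_eq_withDensity :
    stdComplexGaussian = (volume : Measure ℂ).withDensity
      fun z => ENNReal.ofReal (Real.pi⁻¹ * Real.exp (-‖z‖ ^ 2)) := by
  have hhalf : (1 / 2 : ℝ≥0) ≠ 0 := by norm_num
  have hmp := Complex.volume_preserving_equiv_real_prod.symm
  rw [stdComplexGaussian, gaussianReal_of_var_ne_zero 0 hhalf,
    prod_withDensity (measurable_gaussianPDF _ _) (measurable_gaussianPDF _ _),
    ← Measure.volume_eq_prod]
  have hfun : (fun x : ℝ × ℝ => (⟨x.1, x.2⟩ : ℂ)) = Complex.measurableEquivRealProd.symm := by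
    exact funext fun x => Complex.ext (by simp) (by simp)
  rw [hfun]
  ext s hs
  rw [Measure.map_apply (MeasurableEquiv.measurable _) hs, withDensity_apply _ hs,
    withDensity_apply _ (MeasurableEquiv.measurable _ hs)]
  rw [← hmp.setLIntegral_comp_preimage hs (by fun_prop)]
  refine lintegral_congr fun x => ?_
  rw [gaussianPDF, gaussianPDF, ← ENNReal.ofReal_mul (gaussianPDFReal_nonneg _ _ _)]
  congr 1
  have hn : ‖Complex.measurableEquivRealProd.symm x‖ ^ 2 = x.1 ^ 2 + x.2 ^ 2 := by
    rw [← Complex.normSq_eq_norm_sq, Complex.normSq_apply]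
    simp [sq]
  have hs : √(2 * Real.pi * (1 / 2 : ℝ≥0)) * √(2 * Real.pi * (1 / 2 : ℝ≥0)) = Real.pi := by
    rw [Real.mul_self_sqrt (by positivity)]
    push_cast; ring
  rw [hn, gaussianPDFReal, gaussianPDFReal, mul_mul_mul_comm, ← mul_inv, hs, ← Real.exp_add]
  congr 2
  push_cast; ring

theorem integrable_stdComplexGaussian_moment (k l : ℕ) :
    Integrable (fun z : ℂ => z ^ k * (starRingEnd ℂ z) ^ l) stdComplexGaussian := by
  have hL : ∀ q : ℕ, Integrable (fun x : ℝ => ‖x‖ ^ q) (gaussianReal 0 (1 / 2)) := fun q =>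
    (memLp_id_gaussianReal (μ := 0) (v := 1 / 2) (q : ℝ≥0)).integrable_norm_pow'
  rw [stdComplexGaussian, integrable_map_measure (by fun_prop) measurable_complex_mk.aemeasurable]
  have hdom : Integrable (fun x : ℝ × ℝ => (2 : ℝ) ^ (k + l) * (‖x.1‖ ^ (k + l) * 1) +
      2 ^ (k + l) * (1 * ‖x.2‖ ^ (k + l)))
      ((gaussianReal 0 (1 / 2)).prod (gaussianReal 0 (1 / 2))) :=
    (((hL (k + l)).mul_prod (integrable_const 1)).const_mul _).add
      (((integrable_const 1).mul_prod (hL (k + l))).const_mul _)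
  refine hdom.mono' ((by fun_prop : AEStronglyMeasurable
    (fun z : ℂ => z ^ k * (starRingEnd ℂ z) ^ l) _).comp_measurable
      measurable_complex_mk) (ae_of_all _ fun x => ?_)
  simp only [Function.comp, norm_mul, norm_pow, RCLike.norm_conj, ← pow_add, mul_one, one_mul]
  have h1 : ‖(⟨x.1, x.2⟩ : ℂ)‖ ≤ 2 * max ‖x.1‖ ‖x.2‖ := by
    refine (Complex.norm_le_abs_re_add_abs_im _).trans ?_
    simp only [Real.norm_eq_abs]
    linarith [le_max_left |x.1| |x.2|, le_max_right |x.1| |x.2|]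
  refine (pow_le_pow_left₀ (norm_nonneg _) h1 _).trans ?_
  rw [mul_pow, ← mul_add]
  gcongr
  rcases max_cases ‖x.1‖ ‖x.2‖ with h | h <;> rw [h.1]
  · exact le_add_of_nonneg_right (by positivity)
  · exact le_add_of_nonneg_left (by positivity)

theorem integral_stdComplexGaussian (f : ℂ → ℂ) :
    ∫ z, f z ∂stdComplexGaussian =
      (Real.pi : ℂ)⁻¹ * ∫ z, (Real.exp (-‖z‖ ^ 2) : ℂ) * f z := by
  rw [stdComplexGaussian_eq_withDensity, integral_withDensity_eq_integral_toReal_smul₀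
    (by fun_prop) (ae_of_all _ fun _ => ENNReal.ofReal_lt_top), ← integral_const_mul]
  refine integral_congr_ae (ae_of_all _ fun z => ?_)
  simp only
  rw [ENNReal.toReal_ofReal (by positivity), Complex.real_smul]
  push_cast
  ring

theorem integral_stdComplexGaussian_moment (k l : ℕ) :
    ∫ z, z ^ k * (starRingEnd ℂ z) ^ l ∂stdComplexGaussian = if k = l then (k.factorial : ℂ) else 0 := by
  rw [integral_stdComplexGaussian]
  split_ifs with h
  · subst h
    have h1 : ∀ z : ℂ, (Real.exp (-‖z‖ ^ 2) : ℂ) * (z ^ k * (starRingEnd ℂ z) ^ k) =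
        ((‖z‖ ^ (2 * k : ℝ) * Real.exp (-‖z‖ ^ (2 : ℝ)) : ℝ) : ℂ) := by
      intro z
      rw [← mul_pow, Complex.mul_conj, Complex.normSq_eq_norm_sq]
      have : ‖z‖ ^ (2 * k : ℝ) = (‖z‖ ^ 2) ^ k := by
        rw [Real.rpow_mul (norm_nonneg _)]; norm_cast
      rw [this]
      push_cast
      simp only [Real.rpow_ofNat]
      push_cast
      ring
    simp_rw [h1]
    rw [integral_complex_ofReal, Complex.integral_rpow_mul_exp_neg_rpow (by norm_num)
      (by have : (0 : ℝ) ≤ k := k.cast_nonneg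
          linarith)]
    have : (2 * (k : ℝ) + 2) / 2 = k + 1 := by ring
    rw [this, Real.Gamma_nat_eq_factorial]
    have := Real.pi_ne_zero
    push_cast
    field_simp
  · have hkl : ((k : ℂ) - l) ≠ 0 := sub_ne_zero.mpr (by exact_mod_cast h)
    -- Rotation by this angle preserves Lebesgue measure and the norm, and multiplies `z ^ k * conj
    -- z ^ l` by `exp(iπ) = -1`, so the integral equals its own negative.
    set θ : ℝ := Real.pi / ((k : ℝ) - l) with hθ
    set u : Circle := Circle.exp θ with hu
    have hrot : MeasurePreserving (rotation u) (volume : Measure ℂ) volume :=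
      (rotation u).measurePreserving
    set F : ℂ → ℂ := fun z => (Real.exp (-‖z‖ ^ 2) : ℂ) * (z ^ k * (starRingEnd ℂ z) ^ l) with hF
    have hc : (u : ℂ) ^ k * (starRingEnd ℂ (u : ℂ)) ^ l = -1 := by
      rw [hu, Circle.coe_exp, ← Complex.exp_conj, ← Complex.exp_nat_mul, ← Complex.exp_nat_mul,
        ← Complex.exp_add]
      simp only [map_mul, Complex.conj_ofReal, Complex.conj_I]
      have : (k : ℂ) * (θ * Complex.I) + l * (θ * -Complex.I) = Real.pi * Complex.I := by
        rw [hθ]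
        push_cast
        field_simp
        ring
      rw [this, Complex.exp_pi_mul_I]
    have hFu : ∀ z, F (rotation u z) = - F z := by
      intro z
      simp only [hF, rotation_apply, map_mul, norm_mul, Circle.norm_coe, one_mul, mul_pow]
      linear_combination ((Real.exp (-‖z‖ ^ 2) : ℂ) * (z ^ k * (starRingEnd ℂ z) ^ l)) * hc
    have h2 : ∫ z, F (rotation u z) = ∫ z, F z :=
      hrot.integral_comp (rotation u).toHomeomorph.measurableEmbedding F
    simp_rw [hFu] at h2
    rw [integral_neg] at h2
    have : ∫ z, F z = 0 := by linear_combination (-1 / 2 : ℂ) * h2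
    rw [this, mul_zero]

/-! ### Wick's formula -/

/-- If the fibres match in size, the solutions `α` form a coset of the stabilizer of `x`, which is a
product of symmetric groups of the fibres. The right-hand side has the shape of a product of
Gaussian moments. -/
theorem card_perm_comp_eq {I E : Type*} [Fintype I] [DecidableEq I] [Fintype E] [DecidableEq E]
    (x y : I → E) :
    Fintype.card {α : Equiv.Perm I // x ∘ α = y} =
      ∏ e, if Fintype.card {t // x t = e} = Fintype.card {t // y t = e} then
        (Fintype.card {t // x t = e}).factorial else 0 := by
  by_cases h : ∀ e, Fintype.card {t // x t = e} = Fintype.card {t // y t = e}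
  · let α₀ : Equiv.Perm I := Equiv.ofFiberEquiv (f := y) (g := x)
      fun e => Fintype.equivOfCardEq (h e).symm
    have hα₀ : x ∘ α₀ = y := funext fun t => Equiv.ofFiberEquiv_map _ t
    have hcard : Fintype.card {α : Equiv.Perm I // x ∘ α = y} =
        Fintype.card {g : Equiv.Perm I // x ∘ g = x} := by
      refine Fintype.card_congr ((Equiv.mulRight α₀⁻¹).subtypeEquiv fun α => ?_)
      simp only [Equiv.coe_mulRight, Equiv.Perm.coe_mul, ← Function.comp_assoc, ← hα₀]
      constructor
      · intro hα
        rw [hα, Function.comp_assoc]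
        funext t; simp
      · intro hα
        conv_rhs => rw [← hα]
        rw [Function.comp_assoc]
        funext t; simp
    rw [hcard, DomMulAct.stabilizer_card]
    exact Finset.prod_congr rfl fun e _ => by rw [if_pos (h e)]
  · obtain ⟨e, he⟩ := not_forall.mp h
    rw [Finset.prod_eq_zero (Finset.mem_univ e) (by rw [if_neg he]), Fintype.card_eq_zero_iff]
    refine ⟨fun ⟨α, hα⟩ => he ?_⟩
    subst hα
    exact Fintype.card_congr (α⁻¹.subtypeEquiv fun t => by simp)

section Wick

variable {Ω E I : Type*} [MeasurableSpace Ω] {P : Measure Ω}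
  [Fintype E] [Fintype I] {g : E → Ω → ℂ}

theorem prod_mul_conj_eq_prod_fibers [DecidableEq E] (z : E → ℂ) (x y : I → E) :
    ∏ t, z (x t) * starRingEnd ℂ (z (y t)) =
      ∏ e, z e ^ Fintype.card {t // x t = e} *
        starRingEnd ℂ (z e) ^ Fintype.card {t // y t = e} := by
  have h : ∀ (w : E → ℂ) (x : I → E), ∏ t, w (x t) = ∏ e, w e ^ Fintype.card {t // x t = e} := by
    intro w x
    rw [← Finset.prod_fiberwise (Finset.univ : Finset I) x fun t => w (x t)]
    refine Finset.prod_congr rfl fun e _ => ?_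
    rw [Fintype.card_subtype, ← Finset.prod_const]
    exact Finset.prod_congr rfl fun t ht => by rw [(Finset.mem_filter.mp ht).2]
  rw [Finset.prod_mul_distrib, Finset.prod_mul_distrib, h z x,
    h (fun e => starRingEnd ℂ (z e)) y]

theorem integrable_prod_gaussian (hlaw : ∀ e, HasLaw (g e) stdComplexGaussian P)
    (hind : iIndepFun g P) (x y : I → E) :
    Integrable (fun ω => ∏ t, g (x t) ω * starRingEnd ℂ (g (y t) ω)) P := by
  classical
  have hm : ∀ e, AEMeasurable (g e) P := fun e => (hlaw e).aemeasurable
  have hmap : P.map (fun ω e => g e ω) = Measure.pi fun _ : E => stdComplexGaussian := by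
    rw [hind.map_fun_eq_pi_map hm]
    simp_rw [(hlaw _).map_eq]
  have hint : Integrable (fun z : E → ℂ => ∏ e, z e ^ Fintype.card {t // x t = e} *
      starRingEnd ℂ (z e) ^ Fintype.card {t // y t = e}) (P.map (fun ω e => g e ω)) := by
    rw [hmap]
    exact Integrable.fintype_prod (f := fun e (z : ℂ) => z ^ Fintype.card {t // x t = e} *
      starRingEnd ℂ z ^ Fintype.card {t // y t = e})
      fun e => integrable_stdComplexGaussian_moment _ _
  refine (hint.comp_aemeasurable (aemeasurable_pi_lambda _ hm)).congr (ae_of_all _ fun ω => ?_)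
  exact (prod_mul_conj_eq_prod_fibers (fun e => g e ω) x y).symm

/-- Independence splits the integral into moments of single variables, each equal to `k!` or `0`; by
`card_perm_comp_eq` their product counts the permutations matching `x` with `y`. -/
theorem integral_prod_gaussian [DecidableEq I] [DecidableEq E]
    (hlaw : ∀ e, HasLaw (g e) stdComplexGaussian P) (hind : iIndepFun g P) (x y : I → E) :
    ∫ ω, ∏ t, g (x t) ω * starRingEnd ℂ (g (y t) ω) ∂P =
      ∑ α : Equiv.Perm I, ∏ t, if x (α t) = y t then (1 : ℂ) else 0 := by
  have hm : ∀ e, AEMeasurable (g e) P := fun e => (hlaw e).aemeasurable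
  have h1 : ∀ ω, ∏ t, g (x t) ω * starRingEnd ℂ (g (y t) ω) =
      ∏ e, g e ω ^ Fintype.card {t // x t = e} *
        starRingEnd ℂ (g e ω) ^ Fintype.card {t // y t = e} :=
    fun ω => prod_mul_conj_eq_prod_fibers (fun e => g e ω) x y
  have h2 := hind.integral_fun_prod_comp hm (f := fun e (z : ℂ) =>
    z ^ Fintype.card {t // x t = e} * starRingEnd ℂ z ^ Fintype.card {t // y t = e})
    fun e => by fun_prop
  have h3 : ∀ (e : E) (k l : ℕ), ∫ ω, g e ω ^ k * starRingEnd ℂ (g e ω) ^ l ∂P =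
      if k = l then (k.factorial : ℂ) else 0 := by
    intro e k l
    rw [← integral_stdComplexGaussian_moment, ← (hlaw e).map_eq,
      integral_map (hm e) (by fun_prop)]
  have h4 : ∀ α : Equiv.Perm I, (∏ t, if x (α t) = y t then (1 : ℂ) else 0) =
      if x ∘ α = y then 1 else 0 := by
    intro α
    rw [Finset.prod_ite_zero]
    simp [funext_iff]
  simp_rw [h1, h2, h3, h4]
  rw [Finset.sum_boole, ← Fintype.card_subtype, card_perm_comp_eq]
  push_cast
  rfl

end Wick

/-! ## Bypassing a point of a permutation -/

/-- Describing orbits through invariant functions makes their behaviour under `bypass` a consequence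
of `comp_eq_iff_comp_bypass`, without iterating the permutation. -/
theorem sameCycle_iff_forall_invariant {I : Type*} {α : Equiv.Perm I} {x y : I} :
    α.SameCycle x y ↔ ∀ l : I → Prop, (∀ t, l (α t) = l t) → l x = l y := by
  constructor
  · rintro ⟨i, rfl⟩ l hl
    have hnat : ∀ (n : ℕ) (x : I), l ((α ^ n) x) = l x := by
      intro n
      induction n with
      | zero => simp
      | succ n ih => intro x; rw [pow_succ', Equiv.Perm.mul_apply, hl, ih]
    obtain ⟨n, rfl | rfl⟩ := i.eq_nat_or_neg
    · rw [zpow_natCast, hnat]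
    · conv_lhs => rw [← hnat n]
      rw [hnat, ← hnat n ((α ^ (-(n : ℤ))) x)]
      simp
  · intro h
    have := h (α.SameCycle x) fun t => by rw [Equiv.Perm.sameCycle_apply_right]
    exact this ▸ Equiv.Perm.SameCycle.refl _ _

section Bypass

variable {I : Type*} [DecidableEq I]

/-- The permutation obtained from `α` by skipping the point `u`, which becomes a fixed point. -/
def bypass (α : Equiv.Perm I) (u : I) : Equiv.Perm I := Equiv.swap u (α u) * α

theorem bypass_self (α : Equiv.Perm I) (u : I) : bypass α u u = u := by simp [bypass]

theorem bypass_of_eq {α : Equiv.Perm I} {t u : I} (h : α t = u) : bypass α u t = α u := by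
  simp [bypass, h]

theorem bypass_of_ne {α : Equiv.Perm I} {t u : I} (htu : t ≠ u) (h : α t ≠ u) :
    bypass α u t = α t := by
  simp [bypass, Equiv.swap_apply_of_ne_of_ne h (fun h' => htu (α.injective h'))]

theorem bypass_eq_self {α : Equiv.Perm I} {t : I} (h : α t = t) : bypass α t = α := by
  rw [bypass, h, Equiv.swap_self]; rfl

theorem comp_eq_iff_comp_bypass {K : Type*} {α : Equiv.Perm I} {u : I} {f : I → K} :
    (∀ t, f (α t) = f t) ↔ (∀ t, f (bypass α u t) = f t) ∧ f (α u) = f u := by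
  constructor
  · intro h
    refine ⟨fun t => ?_, h u⟩
    rcases eq_or_ne t u with rfl | htu
    · rw [bypass_self]
    · by_cases hu : α t = u
      · rw [bypass_of_eq hu, h, ← hu, h]
      · rw [bypass_of_ne htu hu, h]
  · rintro ⟨h, hu⟩ t
    rcases eq_or_ne t u with rfl | htu
    · exact hu
    · by_cases hα : α t = u
      · rw [hα, ← hu, ← h t, bypass_of_eq hα]
      · rw [← bypass_of_ne htu hα, h]

theorem sameCycle_bypass_iff {α : Equiv.Perm I} {u x y : I} (hx : x ≠ u) (hy : y ≠ u) :
    (bypass α u).SameCycle x y ↔ α.SameCycle x y := by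
  rw [sameCycle_iff_forall_invariant, sameCycle_iff_forall_invariant]
  constructor
  · intro h l hl
    exact h l (comp_eq_iff_comp_bypass.mp hl).1
  · intro h l hl
    by_cases hu : α u = u
    · exact h l (by rwa [bypass_eq_self hu] at hl)
    -- A predicate invariant under the bypassed permutation is arbitrary at `u`; copying its value
    -- from `α u` makes it invariant under `α`.
    · have := h (Function.update l u (l (α u))) (comp_eq_iff_comp_bypass (u := u) |>.mpr
        ⟨fun t => ?_, by simp [hu]⟩)
      · simpa [hx, hy] using this
      · rcases eq_or_ne t u with rfl | htu
        · rw [bypass_self]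
        · have : bypass α u t ≠ u := by
            intro h'
            exact htu ((bypass α u).injective (h'.trans (bypass_self α u).symm))
          rw [Function.update_of_ne this, Function.update_of_ne htu, hl]

theorem sameCycle_bypass_self_iff {α : Equiv.Perm I} {u x : I} :
    (bypass α u).SameCycle u x ↔ u = x := by
  refine ⟨fun h => ?_, fun h => h ▸ Equiv.Perm.SameCycle.refl _ _⟩
  by_contra hne
  have := h.eq_of_left (bypass_self α u)
  exact hne this

end Bypass

/-! ## Planar permutations -/

section Planar

variable {I : Type*} [LinearOrder I]

/-- `β` maps each point of `S` to the next one in the cyclic order, and fixes the other points. -/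
structure IsCyclicSuccOn (S : Finset I) (β : Equiv.Perm I) : Prop where
  apply_eq_self : ∀ t, t ∉ S → β t = t
  apply_mem : ∀ t ∈ S, β t ∈ S
  of_lt : ∀ t ∈ S, t < β t → ∀ x ∈ S, x ≤ t ∨ β t ≤ x
  of_le : ∀ t ∈ S, β t ≤ t → ∀ x ∈ S, β t ≤ x ∧ x ≤ t

/-- The orbits of `α` form a noncrossing partition, and `α` maps each point to the next one of its
orbit, in the cyclic order. -/
structure IsPlanar (α : Equiv.Perm I) : Prop where
  noncrossing : ∀ a b c d, a < b → b < c → c < d → α.SameCycle a c → α.SameCycle b d →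
    α.SameCycle a b
  of_lt : ∀ t, t < α t → ∀ x, α.SameCycle t x → x ≤ t ∨ α t ≤ x
  of_le : ∀ t, α t ≤ t → ∀ x, α.SameCycle t x → α t ≤ x ∧ x ≤ t

theorem IsCyclicSuccOn.bypass {S : Finset I} {β : Equiv.Perm I} (h : IsCyclicSuccOn S β) {u : I}
    (hu : u ∈ S) : IsCyclicSuccOn (S.erase u) (bypass β u) := by
  obtain ⟨h1, h2, h3, h4⟩ := h
  have key : ∀ t, t ≠ u → (β t = u ∧ _root_.bypass β u t = β u ∧ β u ≠ u) ∨ 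
      (β t ≠ u ∧ _root_.bypass β u t = β t) := by
    intro t ht
    by_cases h : β t = u
    · exact .inl ⟨h, bypass_of_eq h, fun h' => ht (β.injective (h.trans h'.symm))⟩
    · exact .inr ⟨h, bypass_of_ne ht h⟩
  constructor
  · intro t ht
    rcases eq_or_ne t u with rfl | htu
    · exact bypass_self _ _
    · grind
  · intro t ht
    grind
  · intro t ht hlt x hx
    grind
  · intro t ht hlt x hx
    grind

theorem IsPlanar.bypass {α : Equiv.Perm I} (h : IsPlanar α) (u : I) : IsPlanar (bypass α u) := by
  have key : ∀ t, t ≠ u → (α t = u ∧ _root_.bypass α u t = α u ∧ α u ≠ u) ∨ 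
      (α t ≠ u ∧ _root_.bypass α u t = α t) := by
    intro t ht
    by_cases h : α t = u
    · exact .inl ⟨h, bypass_of_eq h, fun h' => ht (α.injective (h.trans h'.symm))⟩
    · exact .inr ⟨h, bypass_of_ne ht h⟩
  have hself := @sameCycle_bypass_self_iff I _ α u
  have hiff := @sameCycle_bypass_iff I _ α u
  have hsymm : ∀ x y, (_root_.bypass α u).SameCycle x y → (_root_.bypass α u).SameCycle y x :=
    fun x y h => h.symm
  obtain ⟨h1, h3, h4⟩ := h
  constructor
  · intro a b c d hab hbc hcd hac hbd
    have ha : a ≠ u := by grind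
    have hb : b ≠ u := by grind
    have hc : c ≠ u := by grind
    have hd : d ≠ u := by grind
    rw [hiff ha hc] at hac
    rw [hiff hb hd] at hbd
    rw [hiff ha hb]
    exact h1 a b c d hab hbc hcd hac hbd
  · intro t hlt x hx
    have ht : t ≠ u := by rintro rfl; rw [bypass_self] at hlt; exact lt_irrefl _ hlt
    have hxu : x ≠ u := by grind
    rw [hiff ht hxu] at hx
    have e1 := fun h => h3 t h x hx
    have e2 := fun h => h4 t h x hx
    have hux : α t = u → α.SameCycle u x := fun h => by
      rw [← h, Equiv.Perm.sameCycle_apply_left]; exact hx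
    have e3 := fun h h' => h3 u h x (hux h')
    have e4 := fun h h' => h4 u h x (hux h')
    have := key t ht
    clear h1 h3 h4 hiff hself hsymm key hux
    grind
  · intro t hlt x hx
    by_cases ht : t = u
    · subst ht
      rw [bypass_self, ← hself.mp hx]
      exact ⟨le_rfl, le_rfl⟩
    have hxu : x ≠ u := by grind
    rw [hiff ht hxu] at hx
    have e1 := fun h => h3 t h x hx
    have e2 := fun h => h4 t h x hx
    have hux : α t = u → α.SameCycle u x := fun h => by
      rw [← h, Equiv.Perm.sameCycle_apply_left]; exact hx
    have e3 := fun h h' => h3 u h x (hux h')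
    have e4 := fun h h' => h4 u h x (hux h')
    have := key t ht
    clear h1 h3 h4 hiff hself hsymm key hux
    grind

end Planar

theorem sameCycle_apply_self {I : Type*} (α : Equiv.Perm I) (t : I) : α.SameCycle t (α t) :=
  Equiv.Perm.sameCycle_apply_right.mpr (Equiv.Perm.SameCycle.refl _ _)

section Planar

variable {I : Type*} [LinearOrder I]

theorem mem_of_sameCycle_of_ne {α : Equiv.Perm I} {S : Finset I} (hα : ∀ t, t ∉ S → α t = t)
    {x y : I} (h : α.SameCycle x y) (hne : x ≠ y) : x ∈ S := by
  by_contra hx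
  exact hne (h.eq_of_left (hα x hx))

/-- Here `u` follows `t` immediately in the cyclic order of `S` and lies in the same orbit, so
inserting it creates no crossing: in any crossing `u` can be replaced by `t`. This keeps
non-planarity alive through the merging steps of the reduction. -/
theorem IsPlanar.of_bypass {α β : Equiv.Perm I} {S : Finset I} (hβ : IsCyclicSuccOn S β)
    (hα : ∀ t, t ∉ S → α t = t) {t u : I} (ht : t ∈ S) (htu : t ≠ u) (hαt : α t = u)
    (hβt : β t = u) (h : IsPlanar (_root_.bypass α u)) : IsPlanar α := by
  have hiff := @sameCycle_bypass_iff I _ α u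
  have hmem : ∀ x y, α.SameCycle x y → x ≠ y → x ∈ S ∧ y ∈ S := fun x y h hne =>
    ⟨mem_of_sameCycle_of_ne hα h hne, mem_of_sameCycle_of_ne hα h.symm hne.symm⟩
  have htu' : α.SameCycle t u := hαt ▸ sameCycle_apply_self α t
  have slt : t < u → ∀ x ∈ S, x ≤ t ∨ u ≤ x := by
    have := hβ.of_lt t ht
    rwa [hβt] at this
  have sle : u ≤ t → ∀ x ∈ S, u ≤ x ∧ x ≤ t := by
    have := hβ.of_le t ht
    rwa [hβt] at this
  have hαu : α u ≠ u := fun h' => htu (α.injective (hαt.trans h'.symm))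
  obtain ⟨h1, h3, h4⟩ := h
  have H : ∀ a b c d, a < b → b < c → c < d → a ≠ u → b ≠ u → c ≠ u → d ≠ u →
      α.SameCycle a c → α.SameCycle b d → α.SameCycle a b := by
    intro a b c d hab hbc hcd ha hb hc hd hac hbd
    rw [← hiff ha hb]
    exact h1 a b c d hab hbc hcd ((hiff ha hc).mpr hac) ((hiff hb hd).mpr hbd)
  constructor
  · intro a b c d hab hbc hcd hac hbd
    obtain ⟨haS, hcS⟩ := hmem a c hac (hab.trans hbc).ne
    obtain ⟨hbS, hdS⟩ := hmem b d hbd (hbc.trans hcd).ne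
    rcases lt_or_gt_of_ne htu with hlt | hgt
    · have sa := slt hlt a haS
      have sb := slt hlt b hbS
      have sc := slt hlt c hcS
      have sd := slt hlt d hdS
      by_cases ha : a = u
      · subst ha
        exact htu'.symm.trans (H t b c d (hlt.trans hab) hbc hcd htu hab.ne' (hab.trans hbc).ne'
          (hab.trans (hbc.trans hcd)).ne' (htu'.trans hac) hbd)
      by_cases hb : b = u
      · subst hb
        rcases eq_or_ne a t with rfl | hat
        · exact htu'
        · exact (H a t c d (lt_of_le_of_ne (sa.resolve_right hab.not_ge) hat) (hlt.trans hbc) hcd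
            ha htu hbc.ne' (hbc.trans hcd).ne' hac (htu'.trans hbd)).trans htu'
      by_cases hc : c = u
      · subst hc
        rcases eq_or_ne b t with rfl | hbt
        · exact hac.trans htu'.symm
        · exact H a b t d hab (lt_of_le_of_ne (sb.resolve_right hbc.not_ge) hbt) (hlt.trans hcd)
            ha hb htu hcd.ne' (hac.trans htu'.symm) hbd
      by_cases hd : d = u
      · subst hd
        rcases eq_or_ne c t with rfl | hct
        · exact hac.trans (htu'.trans hbd.symm)
        · exact H a b c t hab hbc (lt_of_le_of_ne (sc.resolve_right hcd.not_ge) hct)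
            ha hb hc htu hac (hbd.trans htu'.symm)
      exact H a b c d hab hbc hcd ha hb hc hd hac hbd
    -- Wrap-around case: `u` is the least and `t` the greatest point of `S`. So `u` can only play
    -- the role of `a`, and replacing it by `t` turns the quadruple into `b, c, d, t`.
    · have sa := sle hgt.le a haS
      have sd := sle hgt.le d hdS
      by_cases ha : a = u
      · subst ha
        rcases eq_or_ne d t with rfl | hdt
        · exact htu'.symm.trans hbd.symm
        · have := H b c d t hbc hcd (lt_of_le_of_ne sd.2 hdt) hab.ne' (hab.trans hbc).ne'
            (hab.trans (hbc.trans hcd)).ne' htu hbd (hac.symm.trans htu'.symm)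
          exact hac.trans this.symm
      have hua : u < a := lt_of_le_of_ne sa.1 (Ne.symm ha)
      exact H a b c d hab hbc hcd ha (hua.trans hab).ne' (hua.trans (hab.trans hbc)).ne'
        (hua.trans (hab.trans (hbc.trans hcd))).ne' hac hbd
  all_goals
    intro v hv x hx
    rcases eq_or_ne v x with rfl | hvx
    · first
      | exact .inl le_rfl
      | exact ⟨hv, le_rfl⟩
    obtain ⟨hvS, hxS⟩ := hmem v x hx hvx
    have hαv : α v ≠ v := fun h => hvx (hx.eq_of_left h)
    have hαvS := (hmem v (α v) (sameCycle_apply_self α v) hαv.symm).2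
    have hαuS := (hmem u (α u) (sameCycle_apply_self α u) hαu.symm).2
    have lx := fun h => slt h x hxS
    have lv := fun h => slt h v hvS
    have lαv := fun h => slt h _ hαvS
    have lαu := fun h => slt h _ hαuS
    have rx := fun h => sle h x hxS
    have rv := fun h => sle h v hvS
    have rαv := fun h => sle h _ hαvS
    have rαu := fun h => sle h _ hαuS
    have e3 := h3 v
    have e4 := h4 v
    have f3 := h3 t
    have f4 := h4 t
    rw [bypass_of_eq hαt] at f3 f4
    -- Only the arrows into and out of `u` differ between `α` and its bypass.
    have hvcase : v = t ∨ v = u ∨ (v ≠ t ∧ v ≠ u ∧ α v ≠ u ∧ _root_.bypass α u v = α v) := by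
      by_cases h1 : v = t
      · exact .inl h1
      by_cases h2 : v = u
      · exact .inr (.inl h2)
      have h3 : α v ≠ u := fun h => h1 (α.injective (h.trans hαt.symm))
      exact .inr (.inr ⟨h1, h2, h3, bypass_of_ne h2 h3⟩)
    rcases hvcase with rfl | rfl | ⟨g1, g2, g3, g4⟩
    · clear h1 h3 h4 H slt sle hmem hiff e3 e4 f3 f4
      grind
    · have hx' : (_root_.bypass α v).SameCycle t x := (hiff htu hvx.symm).mpr (htu'.trans hx)
      replace f3 := fun h => f3 h x hx'
      replace f4 := fun h => f4 h x hx'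
      clear h1 h3 h4 H slt sle hmem hiff e3 e4 hx' hα hβ
      rcases lt_or_gt_of_ne htu with h5 | h5
      · replace lαv := lαv h5
        replace lx := lx h5
        rcases lt_or_ge t (α v) with h6 | h6 <;> grind
      · replace rαv := rαv h5.le
        replace rx := rx h5.le
        rcases lt_or_ge t (α v) with h6 | h6 <;> grind
    · rw [g4] at e3 e4
      rcases eq_or_ne x u with rfl | hxu
      · have hx' : (_root_.bypass α x).SameCycle v t := (hiff hvx htu).mpr (hx.trans htu'.symm)
        replace e3 := fun h => e3 h t hx'
        replace e4 := fun h => e4 h t hx'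
        clear h1 h3 h4 H slt sle hmem hiff f3 f4
        grind
      · have hx' : (_root_.bypass α u).SameCycle v x := (hiff g2 hxu).mpr hx
        replace e3 := fun h => e3 h x hx'
        replace e4 := fun h => e4 h x hx'
        clear h1 h3 h4 H slt sle hmem hiff f3 f4
        grind

end Planar

/-- The planar analogue of an innermost block being an interval: otherwise a shortest ascent `t < α
t` would enclose points of `S`, and these would be forced to contain a fixed point of `α`. -/
theorem IsPlanar.exists_fixed {p : ℕ} {α β : Equiv.Perm (Fin p)} (h : IsPlanar α)
    {S : Finset (Fin p)} (hβ : IsCyclicSuccOn S β) (hα : ∀ t, t ∉ S → α t = t)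
    (hS : S.Nonempty) : ∃ t ∈ S, α t = t ∨ α t = β t := by
  by_contra! hcon
  have hex : ∃ t ∈ S, t < α t := by
    refine ⟨S.min' hS, S.min'_mem hS, lt_of_le_of_ne (S.min'_le _ ?_) ?_⟩
    · by_contra h'
      have := α.injective (hα _ h')
      rw [this] at h'
      exact h' (S.min'_mem hS)
    · exact ((hcon _ (S.min'_mem hS)).1).symm
  have hne : (S.filter fun t => t < α t).Nonempty := by
    obtain ⟨t, ht, ht'⟩ := hex
    exact ⟨t, Finset.mem_filter.mpr ⟨ht, ht'⟩⟩
  obtain ⟨t, ht, hmin⟩ := Finset.exists_min_image _ (fun t => (α t : ℕ) - (t : ℕ)) hne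
  rw [Finset.mem_filter] at ht
  obtain ⟨htS, hlt⟩ := ht
  have hmem : ∀ s ∈ S, α s ∈ S := by
    intro s hs
    by_contra h'
    have := α.injective (hα _ h')
    rw [this] at h'
    exact h' hs
  have hsc : ∀ s, α.SameCycle s (α s) := sameCycle_apply_self α
  -- a point of `S` strictly between `t` and its image
  have hbet : ∃ s ∈ S, t < s ∧ s < α t := by
    by_contra! hno
    have h1 := hβ.of_lt t htS
    have h2 := hβ.of_le t htS
    have h3 := hno (β t) (hβ.apply_mem t htS)
    have h4 := (hcon t htS).2
    have h5 := hmem t htS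
    by_cases hc : t < β t
    · have := h1 hc _ h5
      have := h3 hc
      grind
    · have := h2 (not_lt.mp hc) _ h5
      grind
  obtain ⟨s, hsS, hts, hst⟩ := hbet
  have hnot : ∀ s, t < s → s < α t → ¬ α.SameCycle t s := by
    intro s h1 h2 h3
    have := h.of_lt t hlt s h3
    grind
  -- By noncrossingness, an orbit meeting the open interval between `t` and `α t` cannot leave it.
  have hstay : ∀ s, t < s → s < α t → t < α s ∧ α s < α t := by
    intro s h1 h2
    have hn := hnot s h1 h2
    constructor
    · by_contra hle
      rcases (not_lt.mp hle).lt_or_eq with h' | h'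
      · have := h.noncrossing (α s) t s (α t) h' h1 h2 (hsc s).symm (hsc t)
        exact hn (this.symm.trans (hsc s).symm)
      · exact hn (h' ▸ (hsc s).symm)
    · by_contra hle
      rcases (not_lt.mp hle).lt_or_eq with h' | h'
      · exact hn (h.noncrossing t s (α t) (α s) h1 h2 h' (hsc t) (hsc s))
      · exact h1.ne (α.injective h')
  -- An ascent inside the interval would be shorter than the chosen one. So `s` and `α s` both
  -- descend; but a descent of a planar permutation lands on the minimum of the orbit, so `α s` is
  -- fixed.
  have hfin : ∀ s ∈ S, t < s → s < α t → α s ≤ s := by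
    intro s hs h1 h2
    by_contra hlt'
    have := hmin s (Finset.mem_filter.mpr ⟨hs, not_le.mp hlt'⟩)
    have := hstay s h1 h2
    simp only [Fin.lt_def, Fin.le_def] at *
    omega
  have h1 := hfin s hsS hts hst
  have h2 := hstay s hts hst
  have h3 := hfin (α s) (hmem s hsS) h2.1 h2.2
  have h4 := (hcon (α s) (hmem s hsS)).1
  have h5 := h.of_le s h1 (α (α s)) ((hsc s).trans (hsc _))
  exact h4 (le_antisymm h3 h5.1)

/-! ## Reduction of planar permutations -/

section Reduction

variable {p : ℕ}

/-- The pairs `(α, β)` that can be brought to the trivial pair on one point by removing points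
`t` of `S` with `α t = t` and points `u` of `S` with `α⁻¹ u = β⁻¹ u`. -/
inductive IsReducible : Finset (Fin p) → Equiv.Perm (Fin p) → Equiv.Perm (Fin p) → Prop
  | single (t : Fin p) : IsReducible {t} 1 1
  | fixed {S : Finset (Fin p)} {α β : Equiv.Perm (Fin p)} {t : Fin p} (ht : t ∈ S) (hα : α t = t)
      (hβ : β t ≠ t) (h : IsReducible (S.erase t) α (bypass β t)) : IsReducible S α β
  | merge {S : Finset (Fin p)} {α β : Equiv.Perm (Fin p)} {t u : Fin p} (hu : u ∈ S) (htu : t ≠ u)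
      (hα : α t = u) (hβ : β t = u) (h : IsReducible (S.erase u) (bypass α u) (bypass β u)) :
      IsReducible S α β

theorem IsCyclicSuccOn.apply_ne_self {I : Type*} [LinearOrder I] {S : Finset I}
    {β : Equiv.Perm I} (h : IsCyclicSuccOn S β) {t : I} (ht : t ∈ S) (hS : S ≠ {t}) : β t ≠ t := by
  intro hβ
  refine hS (Finset.eq_singleton_iff_unique_mem.mpr ⟨ht, fun x hx => ?_⟩)
  have := h.of_le t ht hβ.le x hx
  rw [hβ] at this
  exact le_antisymm this.2 this.1

theorem bypass_apply_of_notMem_erase {I : Type*} [DecidableEq I] {S : Finset I}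
    {α : Equiv.Perm I} (hα : ∀ t, t ∉ S → α t = t) (u : I) (t : I) (ht : t ∉ S.erase u) :
    bypass α u t = t := by
  rcases eq_or_ne t u with rfl | htu
  · exact bypass_self _ _
  · have htS : t ∉ S := fun h => ht (Finset.mem_erase.mpr ⟨htu, h⟩)
    rw [bypass_of_ne htu (by rw [hα t htS]; exact htu), hα t htS]

theorem eq_one_of_fixes_compl_singleton {I : Type*} {α : Equiv.Perm I} {t : I}
    (hα : ∀ s, s ∉ ({t} : Finset I) → α s = s) : α = 1 := by
  ext s
  by_cases hs : s = t
  · subst hs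
    by_contra hne
    exact hne (α.injective (hα (α s) (by simpa using hne)))
  · exact hα s (by simpa using hs)

/-- Either a point can be removed from `S`, or neither `α` nor `β α⁻¹` has fixed points there. -/
theorem IsCyclicSuccOn.reduction_cases {S : Finset (Fin p)} {α β : Equiv.Perm (Fin p)}
    (hβ : IsCyclicSuccOn S β) :
    (∃ t, S = {t}) ∨ (∃ t ∈ S, α t = t ∧ β t ≠ t) ∨
      (∃ t ∈ S, ∃ u ∈ S, t ≠ u ∧ α t = u ∧ β t = u) ∨ (∀ t ∈ S, α t ≠ t ∧ α t ≠ β t) := by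
  by_cases h1 : ∃ t, S = {t}
  · exact .inl h1
  have hne : ∀ t ∈ S, β t ≠ t := fun t ht => hβ.apply_ne_self ht fun h => h1 ⟨t, h⟩
  by_cases h2 : ∃ t ∈ S, α t = t
  · obtain ⟨t, ht, h⟩ := h2
    exact .inr (.inl ⟨t, ht, h, hne t ht⟩)
  by_cases h3 : ∃ t ∈ S, α t = β t
  · obtain ⟨t, ht, h⟩ := h3
    exact .inr (.inr (.inl ⟨t, ht, β t, hβ.apply_mem t ht, (hne t ht).symm, h, rfl⟩))
  push Not at h2 h3
  exact .inr (.inr (.inr fun t ht => ⟨h2 t ht, h3 t ht⟩))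

/-- `IsPlanar.exists_fixed` rules out a stuck pair, and both removals preserve planarity. -/
theorem IsPlanar.isReducible {S : Finset (Fin p)} {α β : Equiv.Perm (Fin p)} (h : IsPlanar α)
    (hβ : IsCyclicSuccOn S β) (hα : ∀ t, t ∉ S → α t = t) (hS : S.Nonempty) :
    IsReducible S α β := by
  induction hn : S.card generalizing S α β with
  | zero => exact absurd hn hS.card_pos.ne'
  | succ n ih =>
    rcases hβ.reduction_cases (α := α) with ⟨t, rfl⟩ | ⟨t, ht, hαt, hβt⟩ | ⟨t, ht, u, hu, htu, hαt, hβt⟩ |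
      hno
    · rw [eq_one_of_fixes_compl_singleton hα, eq_one_of_fixes_compl_singleton hβ.apply_eq_self]
      exact .single t
    · refine .fixed ht hαt hβt (ih h (hβ.bypass ht) (fun s hs => ?_)
        ⟨β t, Finset.mem_erase.mpr ⟨hβt, hβ.apply_mem t ht⟩⟩ (by
          rw [Finset.card_erase_of_mem ht, hn, Nat.add_sub_cancel]))
      rcases eq_or_ne s t with rfl | hst
      · exact hαt
      · exact hα s fun h => hs (Finset.mem_erase.mpr ⟨hst, h⟩)
    · exact .merge hu htu hαt hβt (ih (h.bypass u) (hβ.bypass hu)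
        (bypass_apply_of_notMem_erase hα u) ⟨t, Finset.mem_erase.mpr ⟨htu, ht⟩⟩ (by
          rw [Finset.card_erase_of_mem hu, hn, Nat.add_sub_cancel]))
    · obtain ⟨t, ht, h'⟩ := h.exists_fixed hβ hα hS
      rcases h' with h' | h'
      · exact absurd h' (hno t ht).1
      · exact absurd h' (hno t ht).2

end Reduction

/-! ## Counting invariant functions -/

section Count

variable {I : Type*} [Fintype I] [DecidableEq I] {K : Type*} [Fintype K] [DecidableEq K]

variable (K) in
/-- The number of functions `f : I → K` with `f ∘ α = f ∘ β`. -/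
def agreeCount (α β : Equiv.Perm I) : ℕ :=
  Fintype.card {f : I → K // ∀ t, f (α t) = f (β t)}

/-- In other words, the count is `|K|` to the number of orbits of `βα⁻¹`; working with functions
avoids counting orbits. -/
theorem agreeCount_eq_mul_inv (α β : Equiv.Perm I) :
    agreeCount K α β = agreeCount K (β * α⁻¹) 1 := by
  refine Fintype.card_congr (Equiv.subtypeEquivRight fun f => ?_)
  constructor
  · intro h t
    have := h (α⁻¹ t)
    rw [show α (α⁻¹ t) = t from α.apply_symm_apply t] at this
    exact this.symm
  · intro h t
    have := h (α t)
    rw [Equiv.Perm.mul_apply, show α⁻¹ (α t) = t from α.symm_apply_apply t] at this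
    exact this.symm

/-- Skipping `u` only frees the value at `u`, which was tied to the value at `α u`. -/
theorem agreeCount_bypass {α : Equiv.Perm I} {u : I} (hu : α u ≠ u) :
    agreeCount K (bypass α u) 1 = Fintype.card K * agreeCount K α 1 := by
  rw [agreeCount, agreeCount, ← Fintype.card_prod]
  have hmem : ∀ t, t ≠ u → bypass α u t ≠ u := fun t ht h =>
    ht ((bypass α u).injective (h.trans (bypass_self α u).symm))
  have hupd : ∀ (f : I → K) (x : K), (∀ t, f (bypass α u t) = f t) →
      ∀ t, Function.update f u x (bypass α u t) = Function.update f u x t := by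
    intro f x hf t
    rcases eq_or_ne t u with rfl | ht
    · rw [bypass_self]
    · rw [Function.update_of_ne (hmem t ht), Function.update_of_ne ht, hf]
  refine Fintype.card_congr
    { toFun := fun f => (f.1 u, ⟨Function.update f.1 u (f.1 (α u)), ?_⟩)
      invFun := fun y => ⟨Function.update y.2.1 u y.1, ?_⟩
      left_inv := fun f => by ext t; simp
      right_inv := ?_ }
  · exact comp_eq_iff_comp_bypass.mpr ⟨hupd f.1 _ f.2, by simp [hu]⟩
  · exact hupd _ _ (comp_eq_iff_comp_bypass.mp y.2.2).1
  · rintro ⟨x, f, hf⟩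
    have : f (α u) = f u := hf u
    simp [hu, this]

/-- Since `α` fixes `t`, bypassing `t` in `β` is the same as bypassing it in `βα⁻¹`. -/
theorem agreeCount_fixed {α β : Equiv.Perm I} {t : I} (hα : α t = t) (hβ : β t ≠ t) :
    agreeCount K α (bypass β t) = Fintype.card K * agreeCount K α β := by
  have hinv : α⁻¹ t = t := by rw [Equiv.Perm.inv_eq_iff_eq, hα]
  rw [agreeCount_eq_mul_inv, agreeCount_eq_mul_inv α, ← agreeCount_bypass (u := t)]
  · rw [bypass, bypass, Equiv.Perm.mul_apply, hinv, mul_assoc]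
  · rwa [Equiv.Perm.mul_apply, hinv]

theorem agreeCount_merge {α β : Equiv.Perm I} {t u : I} (hα : α t = u)
    (hβ : β t = u) : agreeCount K (bypass α u) (bypass β u) = agreeCount K α β := by
  refine Fintype.card_congr (Equiv.subtypeEquivRight fun f => ?_)
  have key : ∀ s, s ≠ t → s ≠ u → α s ≠ u ∧ β s ≠ u := fun s hs _ =>
    ⟨fun h => hs (α.injective (h.trans hα.symm)), fun h => hs (β.injective (h.trans hβ.symm))⟩
  constructor
  · intro h s
    by_cases hs : s = t
    · rw [hs, hα, hβ]
    by_cases hs' : s = u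
    · have := h t
      rwa [bypass_of_eq hα, bypass_of_eq hβ, ← hs'] at this
    · have := h s
      rwa [bypass_of_ne hs' (key s hs hs').1, bypass_of_ne hs' (key s hs hs').2] at this
  · intro h s
    by_cases hs : s = t
    · rw [hs, bypass_of_eq hα, bypass_of_eq hβ, h]
    by_cases hs' : s = u
    · rw [hs', bypass_self, bypass_self]
    · rw [bypass_of_ne hs' (key s hs hs').1, bypass_of_ne hs' (key s hs hs').2, h]

theorem agreeCount_one_one : agreeCount K (1 : Equiv.Perm I) 1 = Fintype.card K ^ Fintype.card I := by
  simp [agreeCount]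

/-- Nontrivial orbits have at least two points, so there are at most `|I| - |supp σ| / 2` orbits;
squaring avoids the half. In the induction, bypassing a point shrinks the support by one or two and
gains a factor `|K|`. -/
theorem sq_agreeCount_mul_pow_le (hK : 0 < Fintype.card K) (σ : Equiv.Perm I) :
    agreeCount K σ 1 ^ 2 * Fintype.card K ^ σ.support.card ≤
      Fintype.card K ^ (2 * Fintype.card I) := by
  induction hn : σ.support.card using Nat.strong_induction_on generalizing σ with
  | _ n ih =>
    by_cases hσ : σ = 1
    · subst hσ hn
      rw [agreeCount_one_one]
      simp [← pow_mul, mul_comm]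
    obtain ⟨u, hu⟩ : ∃ u, σ u ≠ u := by
      by_contra! h
      exact hσ (Equiv.ext h)
    have hlt : (bypass σ u).support.card < σ.support.card := Equiv.Perm.card_support_swap_mul hu
    have hsub : σ.support ⊆ insert u (insert (σ u) (bypass σ u).support) := by
      intro s hs
      rw [Equiv.Perm.mem_support] at hs
      simp only [Finset.mem_insert, Equiv.Perm.mem_support]
      by_cases h1 : s = u
      · exact .inl h1
      by_cases h2 : σ s = u
      · by_cases h3 : s = σ u
        · exact .inr (.inl h3)
        · exact .inr (.inr (by rw [bypass_of_eq h2]; exact Ne.symm h3))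
      · exact .inr (.inr (by rw [bypass_of_ne h1 h2]; exact hs))
    have hcard : σ.support.card ≤ (bypass σ u).support.card + 2 :=
      (Finset.card_le_card hsub).trans ((Finset.card_insert_le _ _).trans
        (Nat.succ_le_succ (Finset.card_insert_le _ _)))
    have := ih _ (hn ▸ hlt) (bypass σ u) rfl
    rw [agreeCount_bypass hu] at this
    refine le_trans ?_ this
    rw [← hn]
    calc agreeCount K σ 1 ^ 2 * Fintype.card K ^ σ.support.card
        ≤ agreeCount K σ 1 ^ 2 * Fintype.card K ^ ((bypass σ u).support.card + 2) := by gcongr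
      _ = _ := by ring

/-- The stuck case: `α` and `βα⁻¹` both move all of `S`, so each loses at least `|S| / 2` orbits.
The result is one power of `|K|` short of the value for reducible pairs. -/
theorem agreeCount_mul_pow_le_of_no_fixed (hK : 0 < Fintype.card K) {S : Finset I}
    {α β : Equiv.Perm I} (h : ∀ t ∈ S, α t ≠ t ∧ α t ≠ β t) (hα : ∀ t, t ∉ S → α t = t) :
    agreeCount K α 1 * agreeCount K α β * Fintype.card K ^ S.card ≤
      Fintype.card K ^ (2 * Fintype.card I) := by
  have h1 := sq_agreeCount_mul_pow_le hK α
  have h2 := sq_agreeCount_mul_pow_le hK (β * α⁻¹)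
  rw [← agreeCount_eq_mul_inv] at h2
  have hs1 : S.card ≤ α.support.card := Finset.card_le_card fun t ht => by
    rw [Equiv.Perm.mem_support]; exact (h t ht).1
  have hs2 : S.card ≤ (β * α⁻¹).support.card := Finset.card_le_card fun t ht => by
    rw [Equiv.Perm.mem_support, Equiv.Perm.mul_apply]
    have hmem : α⁻¹ t ∈ S := by
      by_contra h'
      have := hα _ h'
      rw [show α (α⁻¹ t) = t from α.apply_symm_apply t] at this
      exact h' (this ▸ ht)
    have := (h _ hmem).2
    rw [show α (α⁻¹ t) = t from α.apply_symm_apply t] at this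
    exact this.symm
  refine (Nat.pow_le_pow_iff_left two_ne_zero).mp ?_
  calc (agreeCount K α 1 * agreeCount K α β * Fintype.card K ^ S.card) ^ 2
      = (agreeCount K α 1 ^ 2 * Fintype.card K ^ S.card) *
        (agreeCount K α β ^ 2 * Fintype.card K ^ S.card) := by ring
    _ ≤ (agreeCount K α 1 ^ 2 * Fintype.card K ^ α.support.card) *
        (agreeCount K α β ^ 2 * Fintype.card K ^ (β * α⁻¹).support.card) := by gcongr
    _ ≤ _ := by rw [sq (_ ^ (2 * Fintype.card I))]; exact Nat.mul_le_mul h1 h2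

end Count

section PlanarCount

variable {p : ℕ} {K : Type*} [Fintype K] [DecidableEq K]

/-- Genus zero: the left side is unchanged by both reduction steps, the lost factor `|K|` from `|K|
^ |S|` being regained by one of the counts. Points outside `S` are fixed by both permutations and
account for two factors each, hence `2p + 1`. -/
theorem IsReducible.agreeCount_mul_pow {S : Finset (Fin p)} {α β : Equiv.Perm (Fin p)}
    (h : IsReducible S α β) :
    agreeCount K α 1 * agreeCount K α β * Fintype.card K ^ S.card =
      Fintype.card K ^ (2 * p + 1) := by
  induction h with
  | single t =>
    rw [agreeCount_one_one]
    simp only [Fintype.card_fin, Finset.card_singleton]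
    ring
  | @fixed S α β t ht hα hβ _ ih =>
    rw [agreeCount_fixed hα hβ] at ih
    rw [← ih, ← Finset.card_erase_add_one ht]
    ring
  | @merge S α β t u hu htu hα hβ _ ih =>
    have hαu : α u ≠ u := fun h' => htu (α.injective (hα.trans h'.symm))
    rw [agreeCount_bypass hαu, agreeCount_merge hα hβ] at ih
    rw [← ih, ← Finset.card_erase_add_one hu]
    ring

theorem isPlanar_one {I : Type*} [LinearOrder I] : IsPlanar (1 : Equiv.Perm I) := by
  constructor
  · intro a b c d hab hbc _ hac
    rw [Equiv.Perm.sameCycle_one] at hac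
    exact absurd hac (hab.trans hbc).ne
  · intro t ht
    exact absurd ht (lt_irrefl t)
  · intro t _ x hx
    rw [Equiv.Perm.sameCycle_one] at hx
    subst hx
    exact ⟨le_rfl, le_rfl⟩

/-- The same invariant, with `IsPlanar.of_bypass` preventing a non-planar pair from reaching the
trivial one; the reduction therefore ends in the stuck case. -/
theorem agreeCount_mul_pow_le_of_not_isPlanar (hK : 0 < Fintype.card K) {S : Finset (Fin p)}
    {α β : Equiv.Perm (Fin p)} (h : ¬ IsPlanar α) (hβ : IsCyclicSuccOn S β)
    (hα : ∀ t, t ∉ S → α t = t) :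
    agreeCount K α 1 * agreeCount K α β * Fintype.card K ^ S.card ≤ Fintype.card K ^ (2 * p) := by
  induction hn : S.card generalizing S α β with
  | zero =>
    rw [Finset.card_eq_zero] at hn
    refine absurd ?_ h
    have : α = 1 := Equiv.ext fun t => hα t (by simp [hn])
    rw [this]
    exact isPlanar_one
  | succ n ih =>
    rcases hβ.reduction_cases (α := α) with ⟨t, rfl⟩ | ⟨t, ht, hαt, hβt⟩ | ⟨t, ht, u, hu, htu, hαt, hβt⟩ |
      hno
    · rw [eq_one_of_fixes_compl_singleton hα] at h
      exact absurd isPlanar_one h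
    · have := ih h (hβ.bypass ht) (fun s hs => ?_) (by
          rw [Finset.card_erase_of_mem ht, hn, Nat.add_sub_cancel])
      · rw [agreeCount_fixed hαt hβt] at this
        refine le_trans (le_of_eq ?_) this
        ring
      · rcases eq_or_ne s t with rfl | hst
        · exact hαt
        · exact hα s fun h => hs (Finset.mem_erase.mpr ⟨hst, h⟩)
    · have := ih (fun h' => h (h'.of_bypass hβ hα ht htu hαt hβt)) (hβ.bypass hu)
        (bypass_apply_of_notMem_erase hα u) (by
          rw [Finset.card_erase_of_mem hu, hn, Nat.add_sub_cancel])
      have hαu : α u ≠ u := fun h' => htu (α.injective (hαt.trans h'.symm))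
      rw [agreeCount_bypass hαu, agreeCount_merge hαt hβt] at this
      refine le_trans (le_of_eq ?_) this
      ring
    · rw [← hn]
      simpa using agreeCount_mul_pow_le_of_no_fixed hK hno hα

end PlanarCount

/-! ## Orbits -/

section Orbits

variable {I : Type*} [Fintype I] [DecidableEq I]

/-- The orbit of `t` under `α`. -/
def orbitOf (α : Equiv.Perm I) (t : I) : Finset I := Finset.univ.filter (α.SameCycle t)

/-- The set of orbits of `α`. -/
def orbits (α : Equiv.Perm I) : Finset (Finset I) := Finset.univ.image (orbitOf α)

theorem mem_orbitOf {α : Equiv.Perm I} {t x : I} : x ∈ orbitOf α t ↔ α.SameCycle t x := by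
  simp [orbitOf]

theorem mem_orbits {α : Equiv.Perm I} {V : Finset I} : V ∈ orbits α ↔ ∃ t, orbitOf α t = V := by
  simp [orbits]

theorem orbitOf_eq_iff {α : Equiv.Perm I} {s t : I} : orbitOf α s = orbitOf α t ↔ α.SameCycle s t := by
  constructor
  · intro h
    rw [← mem_orbitOf, h, mem_orbitOf]
  · intro h
    ext x
    rw [mem_orbitOf, mem_orbitOf]
    exact ⟨h.symm.trans, h.trans⟩

theorem orbitOf_bypass_self (α : Equiv.Perm I) (u : I) : orbitOf (bypass α u) u = {u} := by
  ext x
  rw [mem_orbitOf, sameCycle_bypass_self_iff, Finset.mem_singleton, eq_comm]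

theorem orbitOf_bypass_of_ne (α : Equiv.Perm I) {t u : I} (htu : t ≠ u) :
    orbitOf (bypass α u) t = (orbitOf α t).erase u := by
  ext x
  rw [mem_orbitOf, Finset.mem_erase, mem_orbitOf]
  rcases eq_or_ne x u with rfl | hx
  · simp only [ne_eq, not_true, false_and, iff_false]
    intro h
    exact htu (sameCycle_bypass_self_iff.mp h.symm).symm
  · rw [sameCycle_bypass_iff htu hx]
    simp [hx]

theorem orbits_one : orbits (1 : Equiv.Perm I) = Finset.univ.image fun t => {t} := by
  have : orbitOf (1 : Equiv.Perm I) = fun t => {t} := by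
    funext t
    ext x
    simp [mem_orbitOf, eq_comm]
  rw [orbits, this]

theorem prod_orbits_one (F : Finset I → ℂ) : ∏ V ∈ orbits (1 : Equiv.Perm I), F V = ∏ t, F {t} := by
  rw [orbits_one, Finset.prod_image fun x _ y _ h => Finset.singleton_injective h]

theorem prod_orbits_eq_mul (α : Equiv.Perm I) (u : I) (F : Finset I → ℂ) :
    ∏ V ∈ orbits α, F V = F (orbitOf α u) * ∏ V ∈ (orbits α).erase (orbitOf α u), F V :=
  (Finset.mul_prod_erase _ _ (mem_orbits.mpr ⟨u, rfl⟩)).symm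

theorem notMem_of_mem_erase_orbitOf {α : Equiv.Perm I} {u x : I} (hx : α.SameCycle u x)
    {V : Finset I} (hV : V ∈ (orbits α).erase (orbitOf α u)) : x ∉ V := by
  intro h
  rw [Finset.mem_erase, mem_orbits] at hV
  obtain ⟨hne, s, rfl⟩ := hV
  exact hne (orbitOf_eq_iff.mpr ((mem_orbitOf.mp h).trans hx.symm))

/-- The orbit of `u` splits into `{u}` and a remainder, which is a genuine orbit because it contains
`t`. -/
theorem prod_orbits_bypass {α : Equiv.Perm I} {t u : I} (htu : t ≠ u) (hα : α t = u)
    (F : Finset I → ℂ) :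
    ∏ V ∈ orbits (bypass α u), F V = F {u} * (F ((orbitOf α u).erase u) *
      ∏ V ∈ (orbits α).erase (orbitOf α u), F V) := by
  have hsc : α.SameCycle u t := by
    rw [← hα, Equiv.Perm.sameCycle_apply_left]
  have ht : t ∈ (orbitOf α u).erase u := Finset.mem_erase.mpr ⟨htu, mem_orbitOf.mpr hsc⟩
  have h : orbits (bypass α u) = insert {u} (insert ((orbitOf α u).erase u)
      ((orbits α).erase (orbitOf α u))) := by
    ext V
    simp only [Finset.mem_insert, Finset.mem_erase, mem_orbits]
    constructor
    · rintro ⟨s, rfl⟩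
      rcases eq_or_ne s u with rfl | hs
      · exact .inl (orbitOf_bypass_self _ _)
      · rw [orbitOf_bypass_of_ne _ hs]
        by_cases hsu : α.SameCycle s u
        · rw [orbitOf_eq_iff.mpr hsu]
          exact .inr (.inl rfl)
        · rw [Finset.erase_eq_of_notMem (by rwa [mem_orbitOf])]
          exact .inr (.inr ⟨fun h => hsu (orbitOf_eq_iff.mp h), s, rfl⟩)
    · rintro (rfl | rfl | ⟨hne, s, rfl⟩)
      · exact ⟨u, orbitOf_bypass_self _ _⟩
      · exact ⟨t, by rw [orbitOf_bypass_of_ne _ htu, orbitOf_eq_iff.mpr hsc]⟩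
      · have hsu : ¬ α.SameCycle s u := fun h => hne (orbitOf_eq_iff.mpr h)
        refine ⟨s, ?_⟩
        rw [orbitOf_bypass_of_ne _ (by rintro rfl; exact hsu (Equiv.Perm.SameCycle.refl _ _)),
          Finset.erase_eq_of_notMem (by rwa [mem_orbitOf])]
  have hu : ∀ V ∈ (orbits α).erase (orbitOf α u), u ∉ V := fun V =>
    notMem_of_mem_erase_orbitOf (Equiv.Perm.SameCycle.refl _ _)
  rw [h, Finset.prod_insert, Finset.prod_insert]
  · intro h'
    exact notMem_of_mem_erase_orbitOf hsc h' ht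
  · rw [Finset.mem_insert]
    rintro (h' | h')
    · rw [← h'] at ht
      exact htu (Finset.mem_singleton.mp ht)
    · exact hu _ h' (Finset.mem_singleton_self u)

end Orbits

/-! ## Sums over index functions -/

/-- Exchanging the coordinate at `u` with the extra variable is an involution. This isolates the sum
over one index while keeping a dummy coordinate, so that removed points can stay in the index set.
-/
theorem sum_sum_update {I κ : Type*} [Fintype I] [DecidableEq I] [Fintype κ] (u : I)
    (F : (I → κ) → ℂ) :
    ∑ h : I → κ, ∑ x : κ, F (Function.update h u x) = Fintype.card κ * ∑ h, F h := by
  rw [← Fintype.sum_prod_type']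
  have hinv : Function.Involutive fun y : (I → κ) × κ => (Function.update y.1 u y.2, y.1 u) := by
    rintro ⟨h, x⟩
    simp
  refine (Equiv.sum_comp hinv.toPerm (fun y : (I → κ) × κ => F y.1)).trans ?_
  simp [Fintype.sum_prod_type, Finset.mul_sum]

/-! ### Twisted traces under reduction -/

section TwistedTrace

variable {I : Type*} [Fintype I] [DecidableEq I] {κ₁ κ₂ : Type*} [Fintype κ₁] [Fintype κ₂]
  [DecidableEq κ₁] [DecidableEq κ₂]

/-- The trace of a tensor product of powers of `Λ`, twisted by permutations of the legs. -/
def twistedTrace (Λ : Matrix (κ₁ × κ₂) (κ₁ × κ₂) ℂ) (α β : Equiv.Perm I) (q : I → ℕ) : ℂ :=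
  ∑ h : I → κ₁ × κ₂, ∏ s, (Λ ^ q s) (h s) ((h (α s)).1, (h (β s)).2)

/-- The partial traces over the first leg of the powers of `Λ` are the scalars `c q`. -/
def HasScalarPartialTraces (Λ : Matrix (κ₁ × κ₂) (κ₁ × κ₂) ℂ) (c : ℕ → ℂ) : Prop :=
  ∀ q b b', ∑ a, (Λ ^ q) (a, b) (a, b') = if b = b' then c q else 0

/-- Both legs leaving `t` go to `u`, so summing over the index at `u` multiplies the two powers of
`Λ`. The point `u` remains with exponent `0` and a free index, which explains the factor; arbitrary
exponents `q` are needed for this step. -/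
theorem twistedTrace_merge (Λ : Matrix (κ₁ × κ₂) (κ₁ × κ₂) ℂ) {α β : Equiv.Perm I} (q : I → ℕ)
    {t u : I} (htu : t ≠ u) (hα : α t = u) (hβ : β t = u) :
    twistedTrace Λ (bypass α u) (bypass β u)
        (Function.update (Function.update q t (q t + q u)) u 0) =
      Fintype.card (κ₁ × κ₂) * twistedTrace Λ α β q := by
  have hαu : α u ≠ u := fun h' => htu (α.injective (hα.trans h'.symm))
  have hβu : β u ≠ u := fun h' => htu (β.injective (hβ.trans h'.symm))
  rw [twistedTrace, twistedTrace, ← sum_sum_update u]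
  refine Finset.sum_congr rfl fun h _ => ?_
  have hut : u ∈ (Finset.univ : Finset I).erase t := by simp [htu.symm]
  simp_rw [← Finset.mul_prod_erase _ _ (Finset.mem_univ t), ← Finset.mul_prod_erase _ _ hut]
  have hrest : ∀ x : κ₁ × κ₂, ∏ s ∈ (Finset.univ.erase t).erase u, (Λ ^ q s)
      (Function.update h u x s) ((Function.update h u x (α s)).1,
        (Function.update h u x (β s)).2) =
      ∏ s ∈ (Finset.univ.erase t).erase u,
        (Λ ^ Function.update (Function.update q t (q t + q u)) u 0 s)
        (h s) ((h (bypass α u s)).1, (h (bypass β u s)).2) := by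
    intro x
    refine Finset.prod_congr rfl fun s hs => ?_
    simp only [Finset.mem_erase, Finset.mem_univ, and_true] at hs
    have h1 : α s ≠ u := fun h => hs.2 (α.injective (h.trans hα.symm))
    have h2 : β s ≠ u := fun h => hs.2 (β.injective (h.trans hβ.symm))
    rw [bypass_of_ne hs.1 h1, bypass_of_ne hs.1 h2, Function.update_of_ne hs.1,
      Function.update_of_ne h1, Function.update_of_ne h2, Function.update_of_ne hs.1,
      Function.update_of_ne hs.2]
  simp_rw [hrest]
  simp only [hα, hβ, Function.update_self, Function.update_of_ne htu, Function.update_of_ne hαu,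
    Function.update_of_ne hβu, bypass_self, bypass_of_eq hα, bypass_of_eq hβ, pow_zero,
    Prod.mk.eta, Matrix.one_apply_eq, one_mul, ← mul_assoc, ← Finset.sum_mul]
  rw [pow_add, Matrix.mul_apply]

/-- The first leg at `t` is closed on itself, so a partial trace appears. Being scalar, it
identifies the second index at `t` with the one at `β t`, and the `β`-predecessor of `t` then points
directly to `β t`. -/
theorem twistedTrace_fixed {Λ : Matrix (κ₁ × κ₂) (κ₁ × κ₂) ℂ} {c : ℕ → ℂ}
    (hΛ : HasScalarPartialTraces Λ c) {α β : Equiv.Perm I} (q : I → ℕ)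
    {t : I} (hα : α t = t) (hβ : β t ≠ t) :
    c (q t) * twistedTrace Λ α (bypass β t) (Function.update q t 0) =
      Fintype.card (κ₁ × κ₂) * twistedTrace Λ α β q := by
  obtain ⟨r, hr⟩ := β.surjective t
  have hrt : r ≠ t := fun h => hβ (h ▸ hr)
  rw [twistedTrace, twistedTrace, ← sum_sum_update t, Finset.mul_sum]
  refine Finset.sum_congr rfl fun h _ => ?_
  have hut : r ∈ (Finset.univ : Finset I).erase t := by simp [hrt]
  simp_rw [← Finset.mul_prod_erase _ _ (Finset.mem_univ t), ← Finset.mul_prod_erase _ _ hut]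
  have hαne : ∀ s, s ≠ t → α s ≠ t := fun s hs h => hs (α.injective (h.trans hα.symm))
  have hrest : ∀ x : κ₁ × κ₂, ∏ s ∈ (Finset.univ.erase t).erase r, (Λ ^ q s)
      (Function.update h t x s) ((Function.update h t x (α s)).1,
        (Function.update h t x (β s)).2) =
      ∏ s ∈ (Finset.univ.erase t).erase r, (Λ ^ Function.update q t 0 s)
        (h s) ((h (α s)).1, (h (bypass β t s)).2) := by
    intro x
    refine Finset.prod_congr rfl fun s hs => ?_
    simp only [Finset.mem_erase, Finset.mem_univ, and_true] at hs
    have h2 : β s ≠ t := fun h => hs.1 (β.injective (h.trans hr.symm))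
    rw [bypass_of_ne hs.2 h2, Function.update_of_ne hs.2,
      Function.update_of_ne (hαne s hs.2), Function.update_of_ne h2, Function.update_of_ne hs.2]
  simp_rw [hrest]
  simp only [hα, hr, Function.update_self, Function.update_of_ne hrt,
    Function.update_of_ne (hαne r hrt), Function.update_of_ne hβ, bypass_self, bypass_of_eq hr,
    pow_zero, Prod.mk.eta, Matrix.one_apply_eq, one_mul, ← mul_assoc, ← Finset.sum_mul]
  congr 1
  rw [Fintype.sum_prod_type_right]
  simp_rw [← Finset.sum_mul, hΛ (q t)]
  simp

theorem twistedTrace_one_one {Λ : Matrix (κ₁ × κ₂) (κ₁ × κ₂) ℂ} {c : ℕ → ℂ}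
    (hΛ : HasScalarPartialTraces Λ c) (q : I → ℕ) :
    twistedTrace Λ (1 : Equiv.Perm I) 1 q = (Fintype.card κ₂ : ℂ) ^ Fintype.card I * ∏ t, c (q t) := by
  have h : ∀ k, ∑ x : κ₁ × κ₂, (Λ ^ k) x x = Fintype.card κ₂ * c k := by
    intro k
    rw [Fintype.sum_prod_type_right]
    simp [hΛ k]
  simp only [twistedTrace, Equiv.Perm.coe_one, id, Prod.mk.eta]
  rw [← Fintype.piFinset_univ, ← Finset.prod_univ_sum (fun _ => Finset.univ)
    (fun s x => (Λ ^ q s) x x)]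
  simp_rw [h]
  rw [Finset.prod_mul_distrib, Finset.prod_const, Finset.card_univ]

end TwistedTrace

/-- Merging accumulates the exponents along an orbit, and removing a fixed point evaluates the
accumulated power by its partial trace. Removed points are orbits contributing `c 0 = |κ₁|`, which
cancels against the dummy factors. -/
theorem IsReducible.twistedTrace_eq {p : ℕ} {κ₁ κ₂ : Type*} [Fintype κ₁] [Fintype κ₂]
    [DecidableEq κ₁] [DecidableEq κ₂] [Nonempty κ₁] [Nonempty κ₂]
    {Λ : Matrix (κ₁ × κ₂) (κ₁ × κ₂) ℂ} {c : ℕ → ℂ} (hΛ : HasScalarPartialTraces Λ c)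
    {S : Finset (Fin p)} {α β : Equiv.Perm (Fin p)} (h : IsReducible S α β) (q : Fin p → ℕ) :
    twistedTrace Λ α β q * (Fintype.card κ₂ : ℂ) ^ S.card =
      (Fintype.card κ₂ : ℂ) ^ (p + 1) * ∏ V ∈ orbits α, c (∑ x ∈ V, q x) := by
  have hc0 : c 0 = Fintype.card κ₁ := by
    have := hΛ 0 (Classical.arbitrary κ₂) (Classical.arbitrary κ₂)
    simpa using this.symm
  have h1 : (Fintype.card κ₁ : ℂ) ≠ 0 := by simp
  have h2 : (Fintype.card κ₂ : ℂ) ≠ 0 := by simp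
  induction h generalizing q with
  | single t =>
    rw [twistedTrace_one_one hΛ, prod_orbits_one fun V => c (∑ x ∈ V, q x)]
    simp only [Fintype.card_fin, Finset.card_singleton, Finset.sum_singleton]
    ring
  | @fixed S α β t ht hα hβ _ ih =>
    have h3 := twistedTrace_fixed hΛ q hα hβ
    have h4 := ih (Function.update q t 0)
    have horb : orbitOf α t = {t} := by
      have := orbitOf_bypass_self α t
      rwa [bypass_eq_self hα] at this
    rw [prod_orbits_eq_mul α t, horb] at h4 ⊢
    have hrest : ∏ V ∈ (orbits α).erase {t}, c (∑ x ∈ V, Function.update q t 0 x) =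
        ∏ V ∈ (orbits α).erase {t}, c (∑ x ∈ V, q x) := by
      refine Finset.prod_congr rfl fun V hV => ?_
      congr 1
      refine Finset.sum_congr rfl fun x hx => ?_
      rw [Function.update_of_ne]
      rintro rfl
      exact notMem_of_mem_erase_orbitOf (Equiv.Perm.SameCycle.refl α x) (horb.symm ▸ hV) hx
    rw [hrest] at h4
    simp only [Finset.sum_singleton, Function.update_self, hc0] at h4 ⊢
    rw [Fintype.card_prod] at h3
    push_cast at h3
    rw [← Finset.card_erase_add_one ht]
    refine mul_left_cancel₀ h1 ?_
    linear_combination (-(Fintype.card κ₂ : ℂ) ^ (S.erase t).card) * h3 + c (q t) * h4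
  | @merge S α β t u hu htu hα hβ _ ih =>
    have h3 := twistedTrace_merge Λ q htu hα hβ
    have h4 := ih (Function.update (Function.update q t (q t + q u)) u 0)
    have hsc : α.SameCycle u t := by
      rw [← hα, Equiv.Perm.sameCycle_apply_left]
    have ht : t ∈ (orbitOf α u).erase u := Finset.mem_erase.mpr ⟨htu, mem_orbitOf.mpr hsc⟩
    have huo : u ∈ orbitOf α u := mem_orbitOf.mpr (Equiv.Perm.SameCycle.refl _ _)
    rw [prod_orbits_bypass htu hα] at h4
    rw [prod_orbits_eq_mul α u]
    have hrest : ∏ V ∈ (orbits α).erase (orbitOf α u),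
        c (∑ x ∈ V, Function.update (Function.update q t (q t + q u)) u 0 x) =
        ∏ V ∈ (orbits α).erase (orbitOf α u), c (∑ x ∈ V, q x) := by
      refine Finset.prod_congr rfl fun V hV => ?_
      congr 1
      refine Finset.sum_congr rfl fun x hx => ?_
      rw [Function.update_of_ne, Function.update_of_ne]
      · rintro rfl
        exact notMem_of_mem_erase_orbitOf hsc hV hx
      · rintro rfl
        exact notMem_of_mem_erase_orbitOf (Equiv.Perm.SameCycle.refl α x) hV hx
    have hsum : ∑ x ∈ (orbitOf α u).erase u,
        Function.update (Function.update q t (q t + q u)) u 0 x = ∑ x ∈ orbitOf α u, q x := by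
      rw [← Finset.add_sum_erase _ _ ht, ← Finset.add_sum_erase _ q huo,
        ← Finset.add_sum_erase _ q ht, Function.update_of_ne htu, Function.update_self]
      have : ∑ x ∈ ((orbitOf α u).erase u).erase t,
          Function.update (Function.update q t (q t + q u)) u 0 x =
          ∑ x ∈ ((orbitOf α u).erase u).erase t, q x := by
        refine Finset.sum_congr rfl fun x hx => ?_
        simp only [Finset.mem_erase] at hx
        rw [Function.update_of_ne hx.2.1, Function.update_of_ne hx.1]
      rw [this]
      ring
    rw [hrest, hsum] at h4
    simp only [Finset.sum_singleton, Function.update_self, hc0] at h4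
    rw [Fintype.card_prod] at h3
    push_cast at h3
    rw [← Finset.card_erase_add_one hu]
    refine mul_left_cancel₀ h1 ?_
    linear_combination (-(Fintype.card κ₂ : ℂ) ^ (S.erase u).card) * h3 + h4

theorem IsReducible.agreeCount_eq_prod {p : ℕ} {K : Type*} [Fintype K] [DecidableEq K] [Nonempty K]
    {S : Finset (Fin p)} {α β : Equiv.Perm (Fin p)} (h : IsReducible S α β) :
    (agreeCount K α 1 : ℂ) = ∏ _V ∈ orbits α, (Fintype.card K : ℂ) := by
  have hK : (Fintype.card K : ℂ) ≠ 0 := by simp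
  induction h with
  | single t =>
    rw [agreeCount_one_one, prod_orbits_one fun _ => (Fintype.card K : ℂ)]
    simp
  | fixed _ _ _ _ ih => exact ih
  | @merge S α β t u hu htu hα hβ _ ih =>
    have hαu : α u ≠ u := fun h' => htu (α.injective (hα.trans h'.symm))
    rw [agreeCount_bypass hαu, prod_orbits_bypass htu hα] at ih
    rw [prod_orbits_eq_mul α u]
    push_cast at ih
    exact mul_left_cancel₀ hK ih

/-! ## Planar permutations and noncrossing partitions -/

section Next

variable {I : Type*} [LinearOrder I]

theorem exists_cyclicSucc {V : Finset I} {x : I} (hx : x ∈ V) :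
    ∃ y ∈ V, (x < y → ∀ z ∈ V, z ≤ x ∨ y ≤ z) ∧ (y ≤ x → ∀ z ∈ V, y ≤ z ∧ z ≤ x) := by
  by_cases h : (V.filter (x < ·)).Nonempty
  · have hmem := Finset.mem_filter.mp ((V.filter (x < ·)).min'_mem h)
    refine ⟨(V.filter (x < ·)).min' h, hmem.1, fun _ z hz => ?_, fun h' => absurd hmem.2 h'.not_gt⟩
    by_cases hxz : x < z
    · exact .inr (Finset.min'_le _ _ (Finset.mem_filter.mpr ⟨hz, hxz⟩))
    · exact .inl (not_lt.mp hxz)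
  · refine ⟨V.min' ⟨x, hx⟩, V.min'_mem _, fun h' => absurd h' (V.min'_le x hx).not_gt,
      fun _ z hz => ⟨V.min'_le z hz, ?_⟩⟩
    by_contra hzx
    exact h ⟨z, Finset.mem_filter.mpr ⟨hz, not_le.mp hzx⟩⟩

theorem IsPlanar.eq_of_sameCycle_iff {α α' : Equiv.Perm I} (h : IsPlanar α) (h' : IsPlanar α')
    (hs : ∀ x y, α.SameCycle x y ↔ α'.SameCycle x y) : α = α' := by
  ext x
  have h1 : α'.SameCycle x (α x) := (hs _ _).mp (sameCycle_apply_self α x)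
  have h2 : α.SameCycle x (α' x) := (hs _ _).mpr (sameCycle_apply_self α' x)
  have e1 := fun k => h.of_lt x k _ h2
  have e2 := fun k => h.of_le x k _ h2
  have e3 := fun k => h'.of_lt x k _ h1
  have e4 := fun k => h'.of_le x k _ h1
  clear h h' hs h1 h2
  rcases lt_or_ge x (α x) with h1 | h1 <;> rcases lt_or_ge x (α' x) with h2 | h2 <;> grind

/-- A partition is the partition into the orbits of a permutation mapping each point to the next
one of its block, in the cyclic order. -/
theorem exists_perm_cyclicSucc [Fintype I] (σ : Finpartition (Finset.univ : Finset I)) :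
    ∃ α : Equiv.Perm I, (∀ x y, α.SameCycle x y ↔ σ.part x = σ.part y) ∧
      (∀ x, x < α x → ∀ z ∈ σ.part x, z ≤ x ∨ α x ≤ z) ∧
      (∀ x, α x ≤ x → ∀ z ∈ σ.part x, α x ≤ z ∧ z ≤ x) := by
  have hself : ∀ x, x ∈ σ.part x := fun x => σ.mem_part (Finset.mem_univ x)
  have hpart : ∀ x y, y ∈ σ.part x → σ.part y = σ.part x := fun x y h =>
    σ.part_eq_of_mem (σ.part_mem.mpr (Finset.mem_univ x)) h
  choose n hn hlt hle using fun x => exists_cyclicSucc (hself x)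
  have hinj : Function.Injective n := by
    intro x y hxy
    have hp : σ.part x = σ.part y := by rw [← hpart _ _ (hn x), ← hpart _ _ (hn y), hxy]
    have hy : y ∈ σ.part x := hp ▸ hself y
    have hx : x ∈ σ.part y := hp ▸ hself x
    have e1 := fun k => hlt x k y hy
    have e2 := fun k => hle x k y hy
    have e3 := fun k => hlt y k x hx
    have e4 := fun k => hle y k x hx
    clear hlt hle hpart
    rcases lt_or_ge x (n x) with h1 | h1 <;> rcases lt_or_ge y (n y) with h2 | h2 <;> grind
  refine ⟨Equiv.ofBijective n (Finite.injective_iff_bijective.mp hinj), fun x y => ?_, hlt, hle⟩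
  set α : Equiv.Perm I := Equiv.ofBijective n (Finite.injective_iff_bijective.mp hinj) with hα
  have hαn : ∀ x, α x = n x := fun x => rfl
  constructor
  · intro h
    have := sameCycle_iff_forall_invariant.mp h (fun z => σ.part x = σ.part z)
      fun t => by rw [hαn, hpart _ _ (hn t)]
    exact this ▸ rfl
  -- Each block is a single orbit: a point that is not the minimum is the image of its predecessor
  -- in the block.
  · have key : ∀ y ∈ σ.part x, α.SameCycle ((σ.part x).min' ⟨x, hself x⟩) y := by
      intro y
      induction y using WellFoundedLT.induction with
      | _ y ih =>
        intro hy
        rcases (Finset.min'_le _ y hy).eq_or_lt with h | h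
        · rw [h]
        have hne : ((σ.part x).filter (· < y)).Nonempty :=
          ⟨_, Finset.mem_filter.mpr ⟨Finset.min'_mem _ ⟨x, hself x⟩, h⟩⟩
        set z := ((σ.part x).filter (· < y)).max' hne with hz
        have hzmem := Finset.mem_filter.mp (Finset.max'_mem _ hne)
        rw [← hz] at hzmem
        have hzp := hpart _ _ hzmem.1
        have hyz : y ∈ σ.part z := hzp ▸ hy
        have hnz : n z ∈ σ.part x := hzp ▸ hn z
        have hmax : n z < y → n z ≤ z := fun h =>
          Finset.le_max' _ _ (Finset.mem_filter.mpr ⟨hnz, h⟩)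
        have hzy : α z = y := by
          rw [hαn]
          have e1 := fun k => hlt z k y hyz
          have e2 := fun k => hle z k y hyz
          have e3 := hzmem.2
          clear hlt hle hpart ih
          rcases lt_or_ge z (n z) with h1 | h1 <;> rcases lt_or_ge (n z) y with h2 | h2 <;> grind
        have := ih z hzmem.2 hzmem.1
        rwa [← hzy, Equiv.Perm.sameCycle_apply_right]
    intro h
    exact (key x (hself x)).symm.trans (key y (h ▸ hself y))

end Next

section Bijection

variable {p : ℕ}

open Classical in
/-- The partition into the orbits of `α`. -/
noncomputable def orbitPartition (α : Equiv.Perm (Fin p)) : Finpartition (Finset.univ : Finset (Fin p)) :=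
  Finpartition.ofSetoid (Equiv.Perm.SameCycle.setoid α)

theorem orbitPartition_parts (α : Equiv.Perm (Fin p)) : (orbitPartition α).parts = orbits α := by
  classical
  ext V
  simp only [orbitPartition, Finpartition.ofSetoid, Finpartition.ofSetSetoid_parts, Finset.mem_image, Finset.mem_univ,
    true_and, mem_orbits]
  refine exists_congr fun a => Eq.congr_left ?_
  ext x
  rw [mem_orbitOf, Finset.mem_filter]
  exact and_iff_right (Finset.mem_univ x)

theorem isNoncrossing_orbitPartition {α : Equiv.Perm (Fin p)} (h : IsPlanar α) :
    IsNoncrossing (orbitPartition α) := by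
  intro B hB C hC a b c d hab hbc hcd haB hcB hbC hdC
  rw [orbitPartition_parts, mem_orbits] at hB hC
  obtain ⟨x, rfl⟩ := hB
  obtain ⟨y, rfl⟩ := hC
  rw [mem_orbitOf] at haB hcB hbC hdC
  rw [orbitOf_eq_iff]
  exact haB.trans ((h.noncrossing a b c d hab hbc hcd (haB.symm.trans hcB)
    (hbC.symm.trans hdC)).trans hbC.symm)

/-- A planar permutation is determined by its orbits, since it must cycle through each of them in
increasing order; conversely every noncrossing partition arises from its cyclic successor map. -/
theorem sum_isPlanar_eq_sum_noncrossing (F : Finset (Fin p) → ℂ) [DecidablePred (IsPlanar (I := Fin p))] :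
    ∑ α : Equiv.Perm (Fin p) with IsPlanar α, ∏ V ∈ orbits α, F V =
      ∑ σ ∈ noncrossingPartitions p, ∏ V ∈ σ.parts, F V := by
  refine Finset.sum_bij (fun α _ => orbitPartition α) ?_ ?_ ?_ ?_
  · intro α hα
    simp only [noncrossingPartitions, Finset.mem_filter, Finset.mem_univ, true_and] at hα ⊢
    exact isNoncrossing_orbitPartition hα
  · intro α hα α' hα' h
    simp only [Finset.mem_filter, Finset.mem_univ, true_and] at hα hα'
    refine hα.eq_of_sameCycle_iff hα' fun x y => ?_
    have hp : orbits α = orbits α' := by rw [← orbitPartition_parts, h, orbitPartition_parts]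
    have key : ∀ {α α' : Equiv.Perm (Fin p)}, orbits α = orbits α' → ∀ x y, α.SameCycle x y →
        α'.SameCycle x y := by
      intro α α' hp x y hxy
      have : orbitOf α x ∈ orbits α' := hp ▸ mem_orbits.mpr ⟨x, rfl⟩
      obtain ⟨z, hz⟩ := mem_orbits.mp this
      have hx : x ∈ orbitOf α' z := hz ▸ mem_orbitOf.mpr (Equiv.Perm.SameCycle.refl _ _)
      have hy : y ∈ orbitOf α' z := hz ▸ mem_orbitOf.mpr hxy
      exact (mem_orbitOf.mp hx).symm.trans (mem_orbitOf.mp hy)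
    exact ⟨key hp x y, key hp.symm x y⟩
  · intro σ hσ
    simp only [noncrossingPartitions, Finset.mem_filter, Finset.mem_univ, true_and] at hσ
    obtain ⟨α, hs, hlt, hle⟩ := exists_perm_cyclicSucc σ
    have hmem : ∀ {x y}, α.SameCycle x y → y ∈ σ.part x := fun {x y} h => by
      rw [(hs x y).mp h]
      exact σ.mem_part (Finset.mem_univ y)
    have hplanar : IsPlanar α := by
      refine ⟨fun a b c d hab hbc hcd hac hbd => ?_, fun t ht x hx => hlt t ht x (hmem hx),
        fun t ht x hx => hle t ht x (hmem hx)⟩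
      rw [hs]
      exact hσ _ (σ.part_mem.mpr (Finset.mem_univ a)) _ (σ.part_mem.mpr (Finset.mem_univ b)) a b c d
        hab hbc hcd (σ.mem_part (Finset.mem_univ a)) (hmem hac) (σ.mem_part (Finset.mem_univ b))
        (hmem hbd)
    refine ⟨α, by simpa using hplanar, ?_⟩
    have horb : ∀ x, orbitOf α x = σ.part x := by
      intro x
      ext y
      rw [mem_orbitOf]
      refine ⟨hmem, fun h => (hs x y).mpr ?_⟩
      exact (σ.part_eq_of_mem (σ.part_mem.mpr (Finset.mem_univ x)) h).symm
    refine Finpartition.ext ?_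
    rw [orbitPartition_parts]
    ext V
    rw [mem_orbits]
    constructor
    · rintro ⟨x, rfl⟩
      rw [horb]
      exact σ.part_mem.mpr (Finset.mem_univ x)
    · intro hV
      obtain ⟨x, hx⟩ := σ.nonempty_of_mem_parts hV
      exact ⟨x, (horb x).trans (σ.part_eq_of_mem hV hx)⟩
  · intro α _
    rw [orbitPartition_parts]

end Bijection

/-! ## Laws of self-adjoint matrices -/

theorem starPow_of_star_eq {A : Type*} [Star A] {x : A} (hx : star x = x) (e : StarExp) :
    starPow x e = x := by
  cases e with
  | one => rfl
  | star => exact hx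

theorem starWord_of_star_eq {A : Type*} [Monoid A] [Star A] {x : A} (hx : star x = x) {p : ℕ}
    (e : Fin p → StarExp) : starWord x e = x ^ p := by
  simp [starWord, starPow_of_star_eq hx]

theorem Matrix.IsHermitian.trace_pow {ι : Type*} [Fintype ι] [DecidableEq ι]
    {A : Matrix ι ι ℂ} (hA : A.IsHermitian) (q : ℕ) :
    (A ^ q).trace = ∑ i, (hA.eigenvalues i : ℂ) ^ q := by
  conv_lhs => rw [hA.spectral_theorem]
  rw [← map_pow, Unitary.conjStarAlgAut_apply, Matrix.trace_mul_comm, ← mul_assoc,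
    Unitary.coe_star_mul_self, one_mul, Matrix.diagonal_pow, Matrix.trace_diagonal]
  simp

theorem exists_isLaw_of_isHermitian {ι : Type*} [Fintype ι] [DecidableEq ι] [Nonempty ι]
    {A : Matrix ι ι ℂ} (hA : A.IsHermitian) : ∃ ρ : Measure ℂ, IsLaw A ρ := by
  set z : ι → ℂ := fun i => (hA.eigenvalues i : ℂ) with hz
  have hcard : (Fintype.card ι : ℝ≥0∞) ≠ 0 := by simp
  -- The eigenvalue distribution; the eigenvalues are real, so on both sides every `*`-word is a
  -- power.
  set ρ : Measure ℂ := (Fintype.card ι : ℝ≥0∞)⁻¹ • ∑ i, Measure.dirac (z i) with hρ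
  have hprob : IsProbabilityMeasure ρ := by
    constructor
    simp [hρ, ENNReal.inv_mul_cancel hcard (ENNReal.natCast_ne_top _)]
  refine ⟨ρ, hprob, ⟨∑ i, ‖z i‖, ?_⟩, ?_⟩
  · refine Measure.ae_smul_measure ?_ _
    rw [ae_iff, Measure.finsetSum_apply]
    refine Finset.sum_eq_zero fun i _ => ?_
    rw [Measure.dirac_apply]
    simp only [Set.indicator_apply, Set.mem_ofPred_eq, Pi.one_apply, ite_eq_right_iff]
    intro h
    exact absurd (Finset.single_le_sum (f := fun i => ‖z i‖) (fun j _ => norm_nonneg _)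
      (Finset.mem_univ i)) h
  · funext p e
    simp only [measureStarMoments, matrixStarMoments, ntrace, hρ]
    rw [starWord_of_star_eq (Matrix.isHermitian_iff_isSelfAdjoint.mp hA), hA.trace_pow,
      integral_smul_measure, integral_finsetSum_measure]
    · simp only [integral_dirac]
      have : ∀ i, starWord (z i) e = z i ^ p := fun i =>
        starWord_of_star_eq (Complex.conj_ofReal _) e
      simp_rw [this]
      simp [hz]
    · intro i _
      exact integrable_dirac (by simp)

/-! ## Free cumulants and compound free Poisson laws -/

theorem Finpartition.card_pos_of_mem_parts {p : ℕ} {σ : Finpartition (Finset.univ : Finset (Fin p))}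
    {V : Finset (Fin p)} (hV : V ∈ σ.parts) : V.card ≠ 0 :=
  (Finset.card_pos.mpr (σ.nonempty_of_mem_parts hV)).ne'

theorem Finpartition.univ_mem_parts_iff {p : ℕ} (hne : (Finset.univ : Finset (Fin p)) ≠ ⊥)
    (σ : Finpartition (Finset.univ : Finset (Fin p))) :
    Finset.univ ∈ σ.parts ↔ σ = Finpartition.indiscrete hne := by
  constructor
  · intro h
    ext V
    simp only [Finpartition.indiscrete_parts, Finset.mem_singleton]
    refine ⟨fun hV => ?_, fun hV => hV ▸ h⟩
    by_contra hVn
    exact σ.ne_bot hV (disjoint_top.mp (σ.disjoint hV h hVn))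
  · rintro rfl
    simp

theorem momentsOfCumulants_congr {κ κ' : StarDistribution}
    (h : ∀ p, p ≠ 0 → ∀ e, κ p e = κ' p e) : momentsOfCumulants κ = momentsOfCumulants κ' := by
  funext p e
  exact Finset.sum_congr rfl fun σ _ => Finset.prod_congr rfl fun V hV =>
    h _ (Finpartition.card_pos_of_mem_parts hV) _

open Classical in
theorem momentsOfCumulants_eq_add (κ : StarDistribution) {p : ℕ} (hp : p ≠ 0)
    (e : Fin p → StarExp) : momentsOfCumulants κ p e = κ p e +
      ∑ σ : {σ : Finpartition (Finset.univ : Finset (Fin p)) //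
          IsNoncrossing σ ∧ Finset.univ ∉ σ.parts},
        ∏ V : {V // V ∈ σ.1.parts}, κ V.1.card (subword e V.1) := by
  have hcast : ∀ (q : ℕ) (h : q = p), κ q (fun i => e (Fin.cast h i)) = κ p e := by
    rintro q rfl
    rfl
  have huniv : κ (Finset.univ : Finset (Fin p)).card (subword e Finset.univ) = κ p e := by
    rw [← hcast _ (Finset.card_fin p)]
    congr 1
    funext i
    have := Finset.orderEmbOfFin_unique (s := (Finset.univ : Finset (Fin p))) rfl
      (f := fun i => Fin.cast (Finset.card_fin p) i) (fun _ => Finset.mem_univ _)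
      (fun _ _ h => h)
    simp only [subword]
    rw [← this]
  have hne : (Finset.univ : Finset (Fin p)) ≠ ⊥ := by
    have : NeZero p := ⟨hp⟩
    exact Finset.univ_nonempty.ne_empty
  have hmem : Finpartition.indiscrete hne ∈ noncrossingPartitions p := by
    simp only [noncrossingPartitions, Finset.mem_filter, Finset.mem_univ, true_and]
    intro B hB C hC
    simp only [Finpartition.indiscrete_parts, Finset.mem_singleton] at hB hC
    simp [hB, hC]
  rw [momentsOfCumulants, ← Finset.add_sum_erase _ _ hmem, Finpartition.indiscrete_parts,
    Finset.prod_singleton, huniv]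
  congr 1
  rw [Finset.sum_subtype (p := fun σ : Finpartition (Finset.univ : Finset (Fin p)) =>
    IsNoncrossing σ ∧ Finset.univ ∉ σ.parts)]
  · refine Finset.sum_congr rfl fun σ _ => ?_
    rw [← Finset.prod_coe_sort]
  · intro σ
    simp [noncrossingPartitions, Finpartition.univ_mem_parts_iff hne, and_comm]

theorem card_lt_of_mem_parts {p : ℕ} {σ : Finpartition (Finset.univ : Finset (Fin p))}
    (hσ : Finset.univ ∉ σ.parts) {V : Finset (Fin p)} (hV : V ∈ σ.parts) : V.card < p := by
  have h : V ≠ Finset.univ := fun h => hσ (h ▸ hV)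
  simpa using Finset.card_lt_card (Finset.ssubset_univ_iff.mpr h)

/-- The moment-cumulant formula is triangular: apart from the one-block term it involves only lower
orders. -/
theorem freeCumulants_momentsOfCumulants (κ : StarDistribution) {p : ℕ} (hp : p ≠ 0)
    (e : Fin p → StarExp) : freeCumulants (momentsOfCumulants κ) p e = κ p e := by
  induction p using Nat.strong_induction_on with
  | _ p ih =>
    rw [freeCumulants, momentsOfCumulants_eq_add κ hp, sub_eq_iff_eq_add]
    congr 1
    refine Finset.sum_congr rfl fun σ _ => Finset.prod_congr rfl fun V _ => ?_
    exact (ih _ (card_lt_of_mem_parts σ.2.2 V.2) (Finpartition.card_pos_of_mem_parts V.2) _).symm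

theorem momentsOfCumulants_zero_length (κ : StarDistribution) (e : Fin 0 → StarExp) :
    momentsOfCumulants κ 0 e = 1 := by
  have hparts : ∀ σ : Finpartition (Finset.univ : Finset (Fin 0)), σ.parts = ∅ := fun σ =>
    Finset.eq_empty_of_forall_notMem fun V hV => (σ.nonempty_of_mem_parts hV).choose.elim0
  have h : noncrossingPartitions 0 = {⊥} := by
    ext σ
    simp only [noncrossingPartitions, Finset.mem_filter, Finset.mem_univ, true_and,
      Finset.mem_singleton]
    exact ⟨fun _ => Finpartition.ext ((hparts σ).trans (hparts ⊥).symm),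
      fun _ _ _ _ _ a => a.elim0⟩
  rw [momentsOfCumulants, h, Finset.sum_singleton, hparts, Finset.prod_empty]

theorem measureStarMoments_dirac_zero {p : ℕ} (hp : p ≠ 0) (e : Fin p → StarExp) :
    measureStarMoments (Measure.dirac 0) p e = 0 := by
  rw [measureStarMoments, integral_dirac, starWord_of_star_eq (star_zero ℂ), zero_pow hp]

theorem freeConvPow_eq_momentsOfCumulants (M : StarDistribution) (k : ℕ) :
    freeConvPow M k = momentsOfCumulants ((k : ℂ) • freeCumulants M) := by
  induction k with
  | zero =>
    funext p e
    rcases eq_or_ne p 0 with rfl | hp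
    · rw [momentsOfCumulants_zero_length, freeConvPow, measureStarMoments, integral_dirac]
      simp [starWord]
    · rw [freeConvPow, measureStarMoments_dirac_zero hp, momentsOfCumulants]
      refine (Finset.sum_eq_zero fun σ _ => ?_).symm
      have : NeZero p := ⟨hp⟩
      obtain ⟨V, hV⟩ := σ.parts_nonempty Finset.univ_nonempty.ne_empty
      exact Finset.prod_eq_zero hV (by simp)
  | succ k ih =>
    rw [freeConvPow, ih, freeConv]
    refine momentsOfCumulants_congr fun p hp e => ?_
    simp only [Pi.add_apply, Pi.smul_apply, smul_eq_mul]
    rw [freeCumulants_momentsOfCumulants _ hp]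
    simp only [Pi.smul_apply, smul_eq_mul]
    push_cast
    ring

/-- The atom at `0` contributes nothing in positive order, so the truncation of `1 - c / k` at `0`
for small `k` is harmless. -/
theorem measureStarMoments_poissonStep {μ : Measure ℂ}
    (hint : ∀ (p : ℕ) (e : Fin p → StarExp), Integrable (fun z : ℂ => starWord z e) μ) {k : ℕ}
    (hk : k ≠ 0) {p : ℕ} (hp : p ≠ 0) (e : Fin p → StarExp) :
    (k : ℂ) * measureStarMoments (poissonStep μ k) p e = measureStarMoments μ p e := by
  have hk' : (k : ℝ≥0∞)⁻¹ ≠ ∞ := by simpa using hk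
  have hz : (k : ℂ) ≠ 0 := by exact_mod_cast hk
  have h0 := measureStarMoments_dirac_zero hp e
  simp only [measureStarMoments] at h0 ⊢
  rw [poissonStep, integral_add_measure, integral_smul_measure, integral_smul_measure, h0]
  · simp [hz]
  · exact (integrable_dirac (by simp)).smul_measure ENNReal.ofReal_ne_top
  · exact (hint p e).smul_measure hk'

/-- By induction the lower cumulants are of order `1 / k`. A partition with at least two blocks then
contributes `o(1 / k)` to the cumulant, whose leading term is the moment itself. -/
theorem tendsto_mul_freeCumulants_poissonStep {μ : Measure ℂ}
    (hint : ∀ (p : ℕ) (e : Fin p → StarExp), Integrable (fun z : ℂ => starWord z e) μ)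
    {p : ℕ} (hp : p ≠ 0) (e : Fin p → StarExp) :
    Tendsto (fun k : ℕ => (k : ℂ) * freeCumulants (measureStarMoments (poissonStep μ k)) p e)
      atTop (𝓝 (measureStarMoments μ p e)) := by
  induction p using Nat.strong_induction_on with
  | _ p ih =>
    have hinv : Tendsto (fun k : ℕ => (k : ℂ)⁻¹) atTop (𝓝 0) := tendsto_inv_atTop_nhds_zero_nat
    have hzero : ∀ q, q < p → q ≠ 0 → ∀ e : Fin q → StarExp,
        Tendsto (fun k : ℕ => freeCumulants (measureStarMoments (poissonStep μ k)) q e)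
          atTop (𝓝 0) := by
      intro q hq hq0 e
      have := hinv.mul (ih q hq hq0 e)
      rw [zero_mul] at this
      refine this.congr' ?_
      filter_upwards [eventually_ne_atTop 0] with k hk
      rw [inv_mul_cancel_left₀ (by exact_mod_cast hk)]
    classical
    have hsum : Tendsto (fun k : ℕ => ∑ σ : {σ : Finpartition (Finset.univ : Finset (Fin p)) //
          IsNoncrossing σ ∧ Finset.univ ∉ σ.parts}, (k : ℂ) * ∏ V : {V // V ∈ σ.1.parts},
          freeCumulants (measureStarMoments (poissonStep μ k)) V.1.card (subword e V.1))
        atTop (𝓝 0) := by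
      rw [← Finset.sum_const_zero]
      refine tendsto_finsetSum _ fun σ _ => ?_
      have : NeZero p := ⟨hp⟩
      obtain ⟨V, hV⟩ := σ.1.parts_nonempty Finset.univ_nonempty.ne_empty
      -- One block absorbs the factor `k`; a second block is needed to make the product vanish in
      -- the limit.
      have hV' : ∃ W ∈ σ.1.parts, W ≠ V := by
        by_contra! hall
        refine σ.2.2 ?_
        have h1 : σ.1.parts = {V} := Finset.eq_singleton_iff_unique_mem.mpr ⟨hV, hall⟩
        have h2 := σ.1.sup_parts
        rw [h1, Finset.sup_singleton] at h2
        rw [h1, Finset.mem_singleton]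
        exact h2.symm
      obtain ⟨W, hW, hWV⟩ := hV'
      have hprod : Tendsto (fun k : ℕ => ∏ W ∈ (Finset.univ : Finset {V // V ∈ σ.1.parts}).erase
          ⟨V, hV⟩, freeCumulants (measureStarMoments (poissonStep μ k)) W.1.card
            (subword e W.1)) atTop (𝓝 0) := by
        have hW' : (⟨W, hW⟩ : {V // V ∈ σ.1.parts}) ∈
            (Finset.univ : Finset {V // V ∈ σ.1.parts}).erase ⟨V, hV⟩ := by
          simpa using hWV
        have := tendsto_finsetProd ((Finset.univ : Finset {V // V ∈ σ.1.parts}).erase ⟨V, hV⟩)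
          fun W _ => hzero _ (card_lt_of_mem_parts σ.2.2 W.2)
            (Finpartition.card_pos_of_mem_parts W.2) (subword e W.1)
        rwa [Finset.prod_eq_zero hW' rfl] at this
      have := (ih _ (card_lt_of_mem_parts σ.2.2 hV) (Finpartition.card_pos_of_mem_parts hV)
        (subword e V)).mul hprod
      rw [mul_zero] at this
      refine this.congr fun k => ?_
      rw [mul_assoc, ← Finset.mul_prod_erase Finset.univ _ (Finset.mem_univ ⟨V, hV⟩)]
    have := (tendsto_const_nhds (x := measureStarMoments μ p e)).sub hsum
    rw [sub_zero] at this
    refine this.congr' ?_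
    filter_upwards [eventually_ne_atTop 0] with k hk
    rw [freeCumulants, mul_sub, measureStarMoments_poissonStep hint hk hp, Finset.mul_sum]

theorem isCompoundFreePoisson_momentsOfCumulants {μ : Measure ℂ}
    (hint : ∀ (p : ℕ) (e : Fin p → StarExp), Integrable (fun z : ℂ => starWord z e) μ) :
    IsCompoundFreePoisson μ (momentsOfCumulants (measureStarMoments μ)) := by
  intro p e
  simp_rw [freeConvPow_eq_momentsOfCumulants]
  exact tendsto_finsetSum _ fun σ _ => tendsto_finsetProd _ fun V hV =>
    tendsto_mul_freeCumulants_poissonStep hint (Finpartition.card_pos_of_mem_parts hV) _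

theorem continuous_starWord {p : ℕ} (e : Fin p → StarExp) :
    Continuous fun z : ℂ => starWord z e := by
  have h : ∀ i, Continuous fun z : ℂ => starPow z (e i) := by
    intro i
    cases e i with
    | one => exact continuous_id
    | star => exact continuous_star
  simp only [starWord, List.prod_ofFn]
  exact continuous_finsetProd _ fun i _ => h i

theorem integrable_starWord_of_bounded {μ : Measure ℂ} [IsFiniteMeasure μ] {R : ℝ}
    (hR : ∀ᵐ z ∂μ, ‖z‖ ≤ R) {p : ℕ} (e : Fin p → StarExp) :
    Integrable (fun z : ℂ => starWord z e) μ := by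
  refine Integrable.of_bound (continuous_starWord e).aestronglyMeasurable (R ^ p) ?_
  filter_upwards [hR] with z hz
  simp only [starWord, List.prod_ofFn, norm_prod]
  have h : ∀ i, ‖starPow z (e i)‖ = ‖z‖ := by
    intro i
    cases e i with
    | one => rfl
    | star => exact norm_star z
  simp only [h, Finset.prod_const, Finset.card_univ, Fintype.card_fin]
  exact pow_le_pow_left₀ (norm_nonneg _) hz _

/-! ## Partial traces of the matrices of easy maps -/

section EasyMap

variable {s N : ℕ}

/-- The function on the points of a partition given by multi-indices on the four half-rows. -/
def rowLabel {N : ℕ} (a c b d : Fin s → Fin N) : (Fin s ⊕ Fin s) ⊕ (Fin s ⊕ Fin s) → Fin N :=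
  Sum.elim (Sum.elim a c) (Sum.elim b d)

theorem RowPartition.delta_eq_one {π : RowPartition s} {a c b d : Fin s → Fin N}
    (h : ∀ x y, π x y → rowLabel a c b d x = rowLabel a c b d y) : π.delta a c b d = 1 :=
  if_pos h

theorem RowPartition.delta_eq_zero {π : RowPartition s} {a c b d : Fin s → Fin N}
    (h : ¬ ∀ x y, π x y → rowLabel a c b d x = rowLabel a c b d y) : π.delta a c b d = 0 :=
  if_neg h

theorem RowPartition.delta_congr {π : RowPartition s} {a c b d a' c' b' d' : Fin s → Fin N}
    (h : (∀ x y, π x y → rowLabel a c b d x = rowLabel a c b d y) ↔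
      ∀ x y, π x y → rowLabel a' c' b' d' x = rowLabel a' c' b' d' y) :
    π.delta a c b d = π.delta a' c' b' d' := by
  by_cases h' : ∀ x y, π x y → rowLabel a c b d x = rowLabel a c b d y
  · rw [delta_eq_one h', delta_eq_one (h.mp h')]
  · rw [delta_eq_zero h', delta_eq_zero fun h'' => h' (h.mpr h'')]

theorem choiMatrix_easyMap_apply (π : RowPartition s) (x y : (Fin s → Fin N) × (Fin s → Fin N)) :
    choiMatrix (π.easyMap N) x y = π.delta x.1 y.1 x.2 y.2 := by
  simp [choiMatrix, RowPartition.easyMap, Matrix.single, ite_and]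

theorem isHermitian_choiMatrix_easyMap {π : RowPartition s} (hsymm : π.middleFlip = π) :
    (choiMatrix (π.easyMap N)).IsHermitian := by
  ext x y
  have hreal : ∀ a c b d : Fin s → Fin N, star (π.delta a c b d) = π.delta a c b d := by
    intro a c b d
    by_cases h : ∀ x y, π x y → rowLabel a c b d x = rowLabel a c b d y
    · rw [RowPartition.delta_eq_one h, star_one]
    · rw [RowPartition.delta_eq_zero h, star_zero]
  rw [Matrix.conjTranspose_apply, choiMatrix_easyMap_apply, choiMatrix_easyMap_apply, hreal]
  have hrow : ∀ z, rowLabel y.1 x.1 y.2 x.2 z =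
      rowLabel x.1 y.1 x.2 y.2 (Sum.map Sum.swap Sum.swap z) := by
    rintro ((z | z) | (z | z)) <;> rfl
  have hswap : ∀ z : (Fin s ⊕ Fin s) ⊕ (Fin s ⊕ Fin s),
      Sum.map Sum.swap Sum.swap (Sum.map Sum.swap Sum.swap z) = z := by
    rintro ((z | z) | (z | z)) <;> rfl
  have hπ : ∀ z w, π z w ↔ π (Sum.map Sum.swap Sum.swap z) (Sum.map Sum.swap Sum.swap w) := by
    intro z w
    conv_lhs => rw [← hsymm]
    exact Iff.rfl
  refine RowPartition.delta_congr ⟨fun h z w hzw => ?_, fun h z w hzw => ?_⟩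
  · have := h _ _ ((hπ z w).mp hzw)
    rwa [hrow, hrow, hswap, hswap] at this
  · rw [hrow, hrow]
    exact h _ _ ((hπ z w).mp hzw)

theorem RowPartition.prod_eq_one_of_isEven {π : RowPartition s} (hπ : π.IsEven)
    (f : (Fin s ⊕ Fin s) ⊕ (Fin s ⊕ Fin s) → ℂ) (hf : ∀ x y, π x y → f x = f y)
    (hf2 : ∀ x, f x ^ 2 = 1) : ∏ x, f x = 1 := by
  classical
  rw [← Finset.prod_fiberwise Finset.univ (fun x => (Quotient.mk π x)) f]
  refine Finset.prod_eq_one fun q _ => ?_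
  induction q using Quotient.inductionOn with
  | _ w =>
    have h1 : ∀ x ∈ Finset.univ.filter fun x => Quotient.mk π x = Quotient.mk π w, f x = f w :=
      fun x hx => hf x w (Quotient.exact (Finset.mem_filter.mp hx).2)
    have h2 : Even (Finset.univ.filter fun x => Quotient.mk π x = Quotient.mk π w).card := by
      have := hπ {x | π x w} (Setoid.mem_classes π w)
      convert this using 1
      rw [← Set.ncard_coe_finset]
      congr 1
      ext x
      simp only [Finset.coe_filter, Finset.mem_univ, true_and, Set.mem_ofPred_eq]
      exact Quotient.eq
    obtain ⟨k, hk⟩ := h2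
    rw [Finset.prod_congr rfl h1, Finset.prod_const, hk, ← two_mul, pow_mul, hf2, one_pow]

/-- When `φ_π` is unital modulo scalars, each block of `π` meets at most one lower leg, even after
joining the left and right halves. -/
theorem exists_leg_label {π : RowPartition s} (hN : 2 ≤ N)
    (hunital : IsUnitalModScalars (π.easyMap N)) :
    ∃ J : (Fin s ⊕ Fin s) ⊕ (Fin s ⊕ Fin s) → Option (Fin s),
      (∀ x y, π x y → J x = J y) ∧
      (∀ j, J (Sum.inl (Sum.inr j)) = J (Sum.inl (Sum.inl j))) ∧
      (∀ i, J (Sum.inr (Sum.inl i)) = some i) ∧ (∀ i, J (Sum.inr (Sum.inr i)) = some i) := by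
  classical
  obtain ⟨c, hc⟩ := hunital
  have hdiag : ∀ b : Fin s → Fin N, ∑ a, π.delta a a b b = c := by
    intro b
    have := congrFun (congrFun hc b) b
    simpa [RowPartition.easyMap, Matrix.one_apply] using this
  have hcard : ∀ b : Fin s → Fin N, c = ((Finset.univ.filter fun a : Fin s → Fin N =>
      ∀ x y, π x y → rowLabel a a b b x = rowLabel a a b b y).card : ℂ) := by
    intro b
    rw [← hdiag b, ← Finset.sum_boole]
    rfl
  -- For a constant `b` the constant `a` is admissible, so the count is positive there; unitality
  -- makes the count independent of `b`, hence positive for all `b`.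
  have hc0 : c ≠ 0 := by
    rw [hcard fun _ => ⟨0, by omega⟩]
    refine Nat.cast_ne_zero.mpr (Finset.card_ne_zero.mpr ⟨fun _ => ⟨0, by omega⟩, ?_⟩)
    rw [Finset.mem_filter]
    refine ⟨Finset.mem_univ _, ?_⟩
    rintro ((x | x) | (x | x)) ((y | y) | (y | y)) _ <;> rfl
  have hex : ∀ b : Fin s → Fin N, ∃ a : Fin s → Fin N,
      ∀ x y, π x y → rowLabel a a b b x = rowLabel a a b b y := by
    intro b
    rw [hcard b, Nat.cast_ne_zero, Finset.card_ne_zero] at hc0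
    obtain ⟨a, ha⟩ := hc0
    exact ⟨a, (Finset.mem_filter.mp ha).2⟩
  set leg : (Fin s ⊕ Fin s) ⊕ (Fin s ⊕ Fin s) → Fin s ⊕ Fin s :=
    Sum.map (Sum.elim id id) (Sum.elim id id) with hleg
  set R : Setoid ((Fin s ⊕ Fin s) ⊕ (Fin s ⊕ Fin s)) := π ⊔ Setoid.ker leg with hR
  have hlegR : ∀ x y, leg x = leg y → R x y := fun x y h => (le_sup_right : _ ≤ R) h
  have hπR : ∀ x y, π x y → R x y := fun x y h => (le_sup_left : _ ≤ R) h
  have hinj : ∀ i i', R (Sum.inr (Sum.inl i)) (Sum.inr (Sum.inl i')) → i = i' := by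
    intro i i' h
    by_contra hne
    let b : Fin s → Fin N := fun k => if k = i then ⟨0, by omega⟩ else ⟨1, by omega⟩
    obtain ⟨a, ha⟩ := hex b
    have hleg' : ∀ x, rowLabel a a b b x = Sum.elim a b (leg x) := by
      rintro ((x | x) | (x | x)) <;> rfl
    have hle : R ≤ Setoid.ker (rowLabel a a b b) := by
      refine sup_le (fun {x y} h => ha x y h) fun {x y} h => ?_
      have h : leg x = leg y := h
      change rowLabel a a b b x = rowLabel a a b b y
      rw [hleg', hleg', h]
    have : b i = b i' := hle h
    simp [b, Ne.symm hne] at this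
  refine ⟨fun x => if h : ∃ i, R x (Sum.inr (Sum.inl i)) then some h.choose else none, ?_⟩
  have hJ : ∀ x i, R x (Sum.inr (Sum.inl i)) →
      (if h : ∃ i, R x (Sum.inr (Sum.inl i)) then some h.choose else none) = some i := by
    intro x i h
    have hx : ∃ i, R x (Sum.inr (Sum.inl i)) := ⟨i, h⟩
    rw [dif_pos hx]
    exact congrArg some (hinj _ _ (R.trans' (R.symm' hx.choose_spec) h))
  have hJ' : ∀ x y, R x y → (if h : ∃ i, R x (Sum.inr (Sum.inl i)) then some h.choose else none) =
      if h : ∃ i, R y (Sum.inr (Sum.inl i)) then some h.choose else none := by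
    intro x y hxy
    by_cases hy : ∃ i, R y (Sum.inr (Sum.inl i))
    · obtain ⟨i, hi⟩ := hy
      rw [hJ y i hi, hJ x i (R.trans' hxy hi)]
    · rw [dif_neg hy, dif_neg]
      rintro ⟨i, hi⟩
      exact hy ⟨i, R.trans' (R.symm' hxy) hi⟩
  exact ⟨fun x y h => hJ' x y (hπR x y h), fun j => hJ' _ _ (hlegR _ _ rfl),
    fun i => hJ _ _ (hlegR _ _ rfl), fun i => hJ _ _ (hlegR _ _ rfl)⟩

section Label

variable {π : RowPartition s} {J : (Fin s ⊕ Fin s) ⊕ (Fin s ⊕ Fin s) → Option (Fin s)}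

/-- Applying the transposition of `b i` and `b' i` at every point labelled `i` respects the blocks
of `π`. It is thus a symmetry of `Λ` and its powers, acting separately on the two legs and carrying
`b` to `b'`. -/
theorem partialTrace_choiMatrix_diag (hJ : ∀ x y, π x y → J x = J y)
    (hJac : ∀ j, J (Sum.inl (Sum.inr j)) = J (Sum.inl (Sum.inl j)))
    (hJb : ∀ i, J (Sum.inr (Sum.inl i)) = some i) (hJd : ∀ i, J (Sum.inr (Sum.inr i)) = some i)
    (q : ℕ) (b b' : Fin s → Fin N) :
    ∑ a, (choiMatrix (π.easyMap N) ^ q) (a, b) (a, b) =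
      ∑ a, (choiMatrix (π.easyMap N) ^ q) (a, b') (a, b') := by
  set ψ : Option (Fin s) → Equiv.Perm (Fin N) := fun o => o.elim 1 fun i => Equiv.swap (b i) (b' i)
    with hψ
  let e₁ : (Fin s → Fin N) ≃ (Fin s → Fin N) :=
    Equiv.piCongrRight fun j => ψ (J (Sum.inl (Sum.inl j)))
  let e₂ : (Fin s → Fin N) ≃ (Fin s → Fin N) := Equiv.piCongrRight fun i => ψ (some i)
  have hΛ : (choiMatrix (π.easyMap N)).submatrix (e₁.prodCongr e₂) (e₁.prodCongr e₂) =
      choiMatrix (π.easyMap N) := by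
    ext x y
    rw [Matrix.submatrix_apply, choiMatrix_easyMap_apply, choiMatrix_easyMap_apply]
    have hrow : ∀ z, rowLabel (e₁ x.1) (e₁ y.1) (e₂ x.2) (e₂ y.2) z =
        ψ (J z) (rowLabel x.1 y.1 x.2 y.2 z) := by
      rintro ((z | z) | (z | z)) <;> simp [rowLabel, e₁, e₂, hJac, hJb, hJd]
    refine RowPartition.delta_congr (forall_congr' fun z => forall_congr' fun w =>
      forall_congr' fun hzw => ?_)
    change rowLabel (e₁ x.1) (e₁ y.1) (e₂ x.2) (e₂ y.2) z =
      rowLabel (e₁ x.1) (e₁ y.1) (e₂ x.2) (e₂ y.2) w ↔ _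
    rw [hrow, hrow, hJ z w hzw, (ψ (J w)).injective.eq_iff]
  have hpow : (choiMatrix (π.easyMap N) ^ q).submatrix (e₁.prodCongr e₂) (e₁.prodCongr e₂) =
      choiMatrix (π.easyMap N) ^ q := by
    have := map_pow (Matrix.reindexAlgEquiv ℂ ℂ (e₁.prodCongr e₂).symm) (choiMatrix (π.easyMap N)) q
    simp only [Matrix.coe_reindexAlgEquiv, Matrix.reindex_apply, Equiv.symm_symm] at this
    rw [this, hΛ]
  have he₂ : e₂ b = b' := by
    funext i
    simp [e₂, hψ]
  conv_lhs => rw [← hpow]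
  simp only [Matrix.submatrix_apply, Equiv.prodCongr_apply, Prod.map_apply, he₂]
  exact Equiv.sum_comp e₁ fun a => (choiMatrix (π.easyMap N) ^ q) (a, b') (a, b')

/-- A conserved parity: `Λ` commutes with a diagonal sign matrix `F` that counts modulo 2 the points
labelled `i` carrying the value `b i`, and `F` takes opposite values at `(a, b)` and `(a, b')`. -/
theorem pow_choiMatrix_apply_eq_zero (heven : π.IsEven) (hJ : ∀ x y, π x y → J x = J y)
    (hJac : ∀ j, J (Sum.inl (Sum.inr j)) = J (Sum.inl (Sum.inl j)))
    (hJb : ∀ i, J (Sum.inr (Sum.inl i)) = some i) (hJd : ∀ i, J (Sum.inr (Sum.inr i)) = some i)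
    (q : ℕ) (a b b' : Fin s → Fin N) (hb : b ≠ b') :
    (choiMatrix (π.easyMap N) ^ q) (a, b) (a, b') = 0 := by
  classical
  obtain ⟨i, hi⟩ := Function.ne_iff.mp hb
  set f : Fin N → ℂ := fun z => if z = b i then -1 else 1 with hf
  have hf2 : ∀ z, f z ^ 2 = 1 := by
    intro z
    simp only [hf]
    split_ifs <;> norm_num
  set A : (Fin s → Fin N) → ℂ := fun a => ∏ j, if J (Sum.inl (Sum.inl j)) = some i then f (a j) else 1
    with hA
  set F : (Fin s → Fin N) × (Fin s → Fin N) → ℂ := fun x => A x.1 * f (x.2 i) with hF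
  have hA2 : ∀ a, A a ^ 2 = 1 := by
    intro a
    rw [hA, ← Finset.prod_pow]
    refine Finset.prod_eq_one fun j _ => ?_
    split_ifs
    · exact hf2 _
    · exact one_pow 2
  have hF2 : ∀ x, F x ^ 2 = 1 := fun x => by rw [hF, mul_pow, hA2, hf2, one_mul]
  have hcomm : ∀ x y, choiMatrix (π.easyMap N) x y * F y = F x * choiMatrix (π.easyMap N) x y := by
    intro x y
    rw [choiMatrix_easyMap_apply]
    by_cases h : ∀ z w, π z w → rowLabel x.1 y.1 x.2 y.2 z = rowLabel x.1 y.1 x.2 y.2 w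
    -- The sign is constant on each block and blocks are even, so the signs over all points multiply
    -- to `1`; this product is `F x * F y`.
    · have hprod := RowPartition.prod_eq_one_of_isEven heven
        (fun z => if J z = some i then f (rowLabel x.1 y.1 x.2 y.2 z) else 1)
        (fun z w hzw => by rw [hJ z w hzw, h z w hzw])
        (fun z => by
          split_ifs
          · exact hf2 _
          · exact one_pow 2)
      simp only [Fintype.prod_sum_type, hJac, hJb, hJd, Option.some.injEq, Finset.prod_ite_eq',
        Finset.mem_univ, if_true, rowLabel, Sum.elim_inl, Sum.elim_inr] at hprod
      have hxy : F x * F y = 1 := by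
        rw [← hprod]
        simp only [hF, hA]
        ring
      have : F x = F y := by
        linear_combination F y * hxy - F x * hF2 y
      rw [this, mul_comm]
    · rw [RowPartition.delta_eq_zero h]
      ring
  have hcomm' : Commute (choiMatrix (π.easyMap N)) (Matrix.diagonal F) := by
    ext x y
    rw [Matrix.mul_diagonal, Matrix.diagonal_mul, hcomm]
  have hpow := congrFun (congrFun (hcomm'.pow_left q).eq (a, b)) (a, b')
  rw [Matrix.mul_diagonal, Matrix.diagonal_mul] at hpow
  have hA0 : A a ≠ 0 := fun h => by simpa [h] using hA2 a
  have h1 : F (a, b) = - A a := by simp [hF, hf]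
  have h2 : F (a, b') = A a := by simp [hF, hf, Ne.symm hi]
  rw [h1, h2] at hpow
  have : A a * (choiMatrix (π.easyMap N) ^ q) (a, b) (a, b') = 0 := by
    linear_combination (1 / 2 : ℂ) * hpow
  exact (mul_eq_zero.mp this).resolve_left hA0

end Label

theorem hasScalarPartialTraces_choiMatrix (hN : 1 ≤ N) {π : RowPartition s} (heven : π.IsEven)
    (hunital : IsUnitalModScalars (π.easyMap N)) :
    HasScalarPartialTraces (choiMatrix (π.easyMap N)) fun q =>
      (Fintype.card (Fin s → Fin N) : ℂ)⁻¹ * (choiMatrix (π.easyMap N) ^ q).trace := by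
  have : NeZero N := ⟨by omega⟩
  have hcard : (Fintype.card (Fin s → Fin N) : ℂ) ≠ 0 := Nat.cast_ne_zero.mpr Fintype.card_ne_zero
  obtain ⟨hdiag, hoff⟩ : (∀ (q : ℕ) (b b' : Fin s → Fin N),
      ∑ a, (choiMatrix (π.easyMap N) ^ q) (a, b) (a, b) =
        ∑ a, (choiMatrix (π.easyMap N) ^ q) (a, b') (a, b')) ∧
      ∀ (q : ℕ) (a b b' : Fin s → Fin N), b ≠ b' →
        (choiMatrix (π.easyMap N) ^ q) (a, b) (a, b') = 0 := by
    -- For `N = 1` there is only one multi-index, and both claims are trivial.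
    rcases hN.eq_or_lt with rfl | hN2
    · exact ⟨fun q b b' => by rw [Subsingleton.elim b b'],
        fun q a b b' h => absurd (Subsingleton.elim b b') h⟩
    · obtain ⟨J, hJ, hJac, hJb, hJd⟩ := exists_leg_label hN2 hunital
      exact ⟨partialTrace_choiMatrix_diag hJ hJac hJb hJd,
        pow_choiMatrix_apply_eq_zero heven hJ hJac hJb hJd⟩
  intro q b b'
  split_ifs with h
  · subst h
    have htr : (choiMatrix (π.easyMap N) ^ q).trace = Fintype.card (Fin s → Fin N) *
        ∑ a, (choiMatrix (π.easyMap N) ^ q) (a, b) (a, b) := by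
      rw [Matrix.trace, Fintype.sum_prod_type_right]
      simp only [Matrix.diag_apply]
      rw [Finset.sum_congr rfl fun b' _ => hdiag q b' b, Finset.sum_const, Finset.card_univ,
        nsmul_eq_mul]
    simp only [htr]
    rw [inv_mul_cancel_left₀ hcard]
  · exact Finset.sum_eq_zero fun a _ => hoff q a b b' h

end EasyMap

/-! ## Expected traces of powers of block-modified Wishart matrices -/

theorem Matrix.pow_succ_apply_eq_sum_paths {ι : Type*} [Fintype ι] [DecidableEq ι]
    (X : Matrix ι ι ℂ) (p : ℕ) (i j : ι) :
    (X ^ (p + 1)) i j = ∑ x : Fin p → ι,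
      ∏ t : Fin (p + 1), X (Fin.cons (α := fun _ => ι) i x t) (Fin.snoc (α := fun _ => ι) x j t) := by
  induction p generalizing i with
  | zero => simp [Fin.snoc]
  | succ p ih =>
    rw [pow_succ', Matrix.mul_apply, ← (Fin.consEquiv fun _ => ι).sum_comp, Fintype.sum_prod_type]
    refine Finset.sum_congr rfl fun k _ => ?_
    rw [ih, Finset.mul_sum]
    refine Finset.sum_congr rfl fun x _ => ?_
    rw [Fin.prod_univ_succ (n := p + 1)]
    simp [Fin.consEquiv, ← Fin.cons_snoc_eq_snoc_cons]

theorem Matrix.trace_pow_succ_eq_sum_cycles {ι : Type*} [Fintype ι] [DecidableEq ι]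
    (X : Matrix ι ι ℂ) (p : ℕ) :
    (X ^ (p + 1)).trace = ∑ x : Fin (p + 1) → ι, ∏ t, X (x t) (x (finRotate (p + 1) t)) := by
  rw [Matrix.trace, ← (Fin.consEquiv fun _ => ι).sum_comp, Fintype.sum_prod_type]
  refine Finset.sum_congr rfl fun i _ => ?_
  rw [Matrix.diag_apply, Matrix.pow_succ_apply_eq_sum_paths]
  refine Finset.sum_congr rfl fun x _ => Finset.prod_congr rfl fun t _ => ?_
  rw [Fin.snoc_eq_cons_rotate]
  rfl

theorem isCyclicSuccOn_finRotate (p : ℕ) : IsCyclicSuccOn Finset.univ (finRotate p) := by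
  cases p with
  | zero => exact ⟨fun t => t.elim0, fun t => t.elim0, fun t => t.elim0, fun t => t.elim0⟩
  | succ p =>
    refine ⟨fun t ht => absurd (Finset.mem_univ t) ht, fun t _ => Finset.mem_univ _,
      fun t _ hlt x _ => ?_, fun t _ hle x _ => ?_⟩
    all_goals
      rcases eq_or_ne t (Fin.last p) with rfl | hne
      · rw [finRotate_last] at *
        first
        | exact absurd hlt (Fin.not_lt_zero _)
        | exact ⟨Fin.zero_le _, Fin.le_last _⟩
      · have := coe_finRotate_of_ne_last hne
        simp only [Fin.lt_def, Fin.le_def] at *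
        omega

theorem sum_fun_prod {I A B : Type*} [Fintype I] [DecidableEq I] [Fintype A] [Fintype B]
    (F : (I → A × B) → ℂ) :
    ∑ x : I → A × B, F x = ∑ a : I → A, ∑ b : I → B, F fun t => (a t, b t) := by
  rw [← (Equiv.arrowProdEquivProdArrow I (fun _ => A) (fun _ => B)).symm.sum_comp,
    Fintype.sum_prod_type]
  rfl

theorem sum_prod_ite_eq_agreeCount {I K : Type*} [Fintype I] [DecidableEq I] [Fintype K]
    [DecidableEq K] (α β : Equiv.Perm I) :
    ∑ f : I → K, ∏ t, (if f (α t) = f (β t) then (1 : ℂ) else 0) = agreeCount K α β := by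
  simp only [Finset.prod_ite_zero, Finset.prod_const_one, Finset.mem_univ, forall_true_left]
  rw [Finset.sum_boole, agreeCount, Fintype.card_subtype]

section Expand

variable {κ : Type*} [Fintype κ] [DecidableEq κ] {d m : ℕ}

theorem LinearMap.apply_eq_sum_choiMatrix (φ : Matrix κ κ ℂ →ₗ[ℂ] Matrix κ κ ℂ)
    (A : Matrix κ κ ℂ) (b b' : κ) :
    φ A b b' = ∑ a, ∑ c, A a c * choiMatrix φ (a, b) (c, b') := by
  conv_lhs => rw [Matrix.matrix_eq_sum_single A]
  simp only [map_sum, Matrix.sum_apply, choiMatrix, Matrix.of_apply]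
  refine Finset.sum_congr rfl fun a _ => Finset.sum_congr rfl fun c _ => ?_
  have : Matrix.single a c (A a c) = A a c • Matrix.single a c 1 := by
    rw [Matrix.smul_single, smul_eq_mul, mul_one]
  rw [this, map_smul, Matrix.smul_apply, smul_eq_mul]

theorem smul_blockModify_wishart_apply (hm : m ≠ 0) (φ : Matrix κ κ ℂ →ₗ[ℂ] Matrix κ κ ℂ)
    (G : Matrix (Fin d × κ) (Fin d × Fin m) ℂ) (x y : Fin d × κ) :
    ((m : ℂ) • blockModify φ (wishart G)) x y =
      ∑ w : κ × κ × (Fin d × Fin m), ((d : ℂ)⁻¹ * choiMatrix φ (w.1, x.2) (w.2.1, y.2)) *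
        (G (x.1, w.1) w.2.2 * starRingEnd ℂ (G (y.1, w.2.1) w.2.2)) := by
  have hm' : (m : ℂ) ≠ 0 := Nat.cast_ne_zero.mpr hm
  rw [Matrix.smul_apply, blockModify, Matrix.of_apply, LinearMap.apply_eq_sum_choiMatrix,
    smul_eq_mul, Fintype.sum_prod_type, Finset.mul_sum]
  refine Finset.sum_congr rfl fun a _ => ?_
  rw [Fintype.sum_prod_type, Finset.mul_sum]
  refine Finset.sum_congr rfl fun c _ => ?_
  simp only [Matrix.of_apply, wishart, Matrix.smul_apply, Matrix.mul_apply,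
    Matrix.conjTranspose_apply, smul_eq_mul]
  rw [← Finset.mul_sum, mul_inv]
  simp only [starRingEnd_apply]
  field_simp

theorem isHermitian_smul_blockModify_wishart (hm : m ≠ 0) {φ : Matrix κ κ ℂ →ₗ[ℂ] Matrix κ κ ℂ}
    (hφ : (choiMatrix φ).IsHermitian) (G : Matrix (Fin d × κ) (Fin d × Fin m) ℂ) :
    ((m : ℂ) • blockModify φ (wishart G)).IsHermitian := by
  ext x y
  rw [Matrix.conjTranspose_apply, smul_blockModify_wishart_apply hm,
    smul_blockModify_wishart_apply hm, star_sum]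
  let e : κ × κ × (Fin d × Fin m) ≃ κ × κ × (Fin d × Fin m) :=
    ⟨fun w => (w.2.1, w.1, w.2.2), fun w => (w.2.1, w.1, w.2.2), fun _ => rfl, fun _ => rfl⟩
  rw [← e.sum_comp]
  refine Finset.sum_congr rfl fun w _ => ?_
  have := hφ.apply (w.1, x.2) (w.2.1, y.2)
  simp only [e, Equiv.coe_fn_mk]
  rw [← this]
  simp only [star_mul', star_inv₀, star_natCast, starRingEnd_apply, star_star]
  ring

variable {Ω : Type*} [MeasurableSpace Ω] {P : Measure Ω}
  {G : Ω → Matrix (Fin d × κ) (Fin d × Fin m) ℂ}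

theorem trace_pow_smul_blockModify_wishart (hm : m ≠ 0) (φ : Matrix κ κ ℂ →ₗ[ℂ] Matrix κ κ ℂ)
    (G : Matrix (Fin d × κ) (Fin d × Fin m) ℂ) (p : ℕ) :
    (((m : ℂ) • blockModify φ (wishart G)) ^ (p + 1)).trace =
      ∑ x : Fin (p + 1) → Fin d × κ, ∑ w : Fin (p + 1) → κ × κ × (Fin d × Fin m),
        (∏ t, (d : ℂ)⁻¹ * choiMatrix φ ((w t).1, (x t).2)
          ((w t).2.1, (x (finRotate (p + 1) t)).2)) *
        ∏ t, G ((x t).1, (w t).1) (w t).2.2 *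
          starRingEnd ℂ (G ((x (finRotate (p + 1) t)).1, (w t).2.1) (w t).2.2) := by
  rw [Matrix.trace_pow_succ_eq_sum_cycles]
  refine Finset.sum_congr rfl fun x _ => ?_
  simp_rw [smul_blockModify_wishart_apply hm]
  rw [Finset.prod_univ_sum, Fintype.piFinset_univ]
  exact Finset.sum_congr rfl fun w _ => Finset.prod_mul_distrib

theorem integrable_trace_pow_smul_blockModify_wishart (hm : m ≠ 0)
    (φ : Matrix κ κ ℂ →ₗ[ℂ] Matrix κ κ ℂ) (hG : IsComplexGaussianMatrix P G) (p : ℕ) :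
    Integrable (fun ω => (((m : ℂ) • blockModify φ (wishart (G ω))) ^ (p + 1)).trace) P := by
  simp_rw [trace_pow_smul_blockModify_wishart hm]
  refine integrable_finsetSum _ fun x _ => integrable_finsetSum _ fun w _ => ?_
  exact (integrable_prod_gaussian (g := fun (y : (Fin d × κ) × (Fin d × Fin m)) ω => G ω y.1 y.2)
    (fun e => hG.hasLaw e.1 e.2) hG.indep
    (fun t => (((x t).1, (w t).1), (w t).2.2))
    fun t => (((x (finRotate (p + 1) t)).1, (w t).2.1), (w t).2.2)).const_mul _

/-- The pairing `α` imposes separate constraints on the block-row indices (equal along `α` and `β`)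
and on the two column indices (invariant under `α`). It also eliminates the index `c` in favour of
`a ∘ α`, leaving the twisted trace. -/
theorem sum_gaussian_pairing (Λ : Matrix (κ × κ) (κ × κ) ℂ) (z : ℂ) {p : ℕ}
    (α β : Equiv.Perm (Fin p)) :
    ∑ x : Fin p → Fin d × κ, ∑ w : Fin p → κ × κ × (Fin d × Fin m),
        (∏ t, z * Λ ((w t).1, (x t).2) ((w t).2.1, (x (β t)).2)) *
        ∏ t, (if (((x (α t)).1, (w (α t)).1), (w (α t)).2.2) =
          (((x (β t)).1, (w t).2.1), (w t).2.2) then (1 : ℂ) else 0) =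
      z ^ p * (agreeCount (Fin d) α β * agreeCount (Fin d) α 1 * agreeCount (Fin m) α 1 *
        twistedTrace Λ α β fun _ => 1) := by
  have hterm : ∀ (i : Fin p → Fin d) (b a c : Fin p → κ) (l : Fin p → Fin d) (k : Fin p → Fin m),
      (∏ t, z * Λ (a t, b t) (c t, b (β t))) *
        ∏ t, (if ((i (α t), a (α t)), (l (α t), k (α t))) = ((i (β t), c t), (l t, k t))
          then (1 : ℂ) else 0) =
      z ^ p * ((∏ t, if i (α t) = i (β t) then (1 : ℂ) else 0) *
        ((if (fun t => a (α t)) = c then ∏ t, Λ (a t, b t) (c t, b (β t)) else 0) *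
        ((∏ t, if l (α t) = l t then (1 : ℂ) else 0) *
          ∏ t, if k (α t) = k t then (1 : ℂ) else 0))) := by
    intro i b a c l k
    have hc : (if (fun t => a (α t)) = c then ∏ t, Λ (a t, b t) (c t, b (β t)) else 0) =
        (∏ t, if a (α t) = c t then (1 : ℂ) else 0) * ∏ t, Λ (a t, b t) (c t, b (β t)) := by
      simp only [Finset.prod_ite_zero, Finset.prod_const_one, Finset.mem_univ, forall_true_left,
        funext_iff, ite_mul, one_mul, zero_mul]
    have hz : z ^ p = ∏ _t : Fin p, z := by simp
    rw [hc, hz]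
    simp only [← Finset.prod_mul_distrib]
    refine Finset.prod_congr rfl fun t _ => ?_
    simp only [Prod.mk.injEq, ite_and]
    split_ifs <;> ring
  have hone : ∀ q, ∑ f : Fin p → Fin q, ∏ t, (if f (α t) = f t then (1 : ℂ) else 0) =
      agreeCount (Fin q) α 1 := fun q => sum_prod_ite_eq_agreeCount (K := Fin q) α 1
  simp_rw [sum_fun_prod]
  simp_rw [hterm, ← Finset.mul_sum, ← Finset.sum_mul]
  rw [hone, hone, sum_prod_ite_eq_agreeCount, twistedTrace, sum_fun_prod, Finset.sum_comm]
  simp only [pow_one, Finset.sum_ite_eq, Finset.mem_univ, if_true]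
  ring

theorem integral_trace_pow_smul_blockModify_wishart (hm : m ≠ 0)
    (φ : Matrix κ κ ℂ →ₗ[ℂ] Matrix κ κ ℂ) (hG : IsComplexGaussianMatrix P G) (p : ℕ) :
    ∫ ω, (((m : ℂ) • blockModify φ (wishart (G ω))) ^ (p + 1)).trace ∂P =
      ∑ α : Equiv.Perm (Fin (p + 1)), (d : ℂ)⁻¹ ^ (p + 1) *
        (agreeCount (Fin d) α (finRotate (p + 1)) * agreeCount (Fin d) α 1 *
          agreeCount (Fin m) α 1 *
          twistedTrace (choiMatrix φ) α (finRotate (p + 1)) fun _ => 1) := by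
  have hlaw : ∀ e : (Fin d × κ) × (Fin d × Fin m),
      HasLaw (fun ω => G ω e.1 e.2) stdComplexGaussian P := fun e => hG.hasLaw e.1 e.2
  have hint : ∀ (x : Fin (p + 1) → Fin d × κ) (w : Fin (p + 1) → κ × κ × (Fin d × Fin m)),
      Integrable (fun ω => ∏ t : Fin (p + 1),
      G ω ((x t).1, (w t).1) (w t).2.2 *
        starRingEnd ℂ (G ω ((x (finRotate (p + 1) t)).1, (w t).2.1) (w t).2.2)) P :=
    fun x w =>
      integrable_prod_gaussian (g := fun (y : (Fin d × κ) × (Fin d × Fin m)) ω => G ω y.1 y.2)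
        hlaw hG.indep (fun t => (((x t).1, (w t).1), (w t).2.2))
        fun t => (((x (finRotate (p + 1) t)).1, (w t).2.1), (w t).2.2)
  simp_rw [trace_pow_smul_blockModify_wishart hm]
  rw [integral_finsetSum _ fun x _ => integrable_finsetSum _ fun w _ => (hint x w).const_mul _]
  simp_rw [integral_finsetSum _ fun w _ => (hint _ w).const_mul _, integral_const_mul]
  have hpair := fun (x : Fin (p + 1) → Fin d × κ) (w : Fin (p + 1) → κ × κ × (Fin d × Fin m)) =>
    integral_prod_gaussian (g := fun (y : (Fin d × κ) × (Fin d × Fin m)) ω => G ω y.1 y.2)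
      hlaw hG.indep (fun t => (((x t).1, (w t).1), (w t).2.2))
      fun t => (((x (finRotate (p + 1) t)).1, (w t).2.1), (w t).2.2)
  simp only at hpair
  simp_rw [hpair, Finset.mul_sum]
  symm
  refine (Finset.sum_congr rfl fun α _ => (sum_gaussian_pairing (choiMatrix φ) _ α _).symm).trans ?_
  rw [Finset.sum_comm]
  refine Finset.sum_congr rfl fun x _ => Finset.sum_comm.trans ?_
  rfl

end Expand

/-! ## The limit of the moments -/

open Classical in
theorem tendsto_agreeCount_ratio {p : ℕ} [NeZero p] (α : Equiv.Perm (Fin p)) :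
    Tendsto (fun d : ℕ => (d : ℂ)⁻¹ ^ (p + 1) *
      (agreeCount (Fin d) α (finRotate p) * agreeCount (Fin d) α 1)) atTop
      (𝓝 (if IsPlanar α then 1 else 0)) := by
  have hcyc := isCyclicSuccOn_finRotate p
  split_ifs with h
  · refine tendsto_const_nhds.congr' ?_
    filter_upwards [eventually_ge_atTop 1] with d hd
    have hd0 : (d : ℂ) ≠ 0 := Nat.cast_ne_zero.mpr (by omega)
    have key := (h.isReducible hcyc (fun t ht => absurd (Finset.mem_univ t) ht)
      Finset.univ_nonempty).agreeCount_mul_pow (K := Fin d)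
    rw [Fintype.card_fin, Finset.card_univ, Fintype.card_fin] at key
    have key' : (agreeCount (Fin d) α 1 : ℂ) * agreeCount (Fin d) α (finRotate p) * (d : ℂ) ^ p =
        (d : ℂ) ^ (2 * p + 1) := by exact_mod_cast key
    rw [inv_pow, eq_comm, inv_mul_eq_one₀ (pow_ne_zero _ hd0)]
    refine mul_right_cancel₀ (pow_ne_zero p hd0) ?_
    rw [mul_comm (agreeCount (Fin d) α (finRotate p) : ℂ), key']
    ring
  -- Non-planar terms are at most `d ^ p / d ^ (p + 1)`, whereas the planar ones are exactly `1`
  -- once `d ≥ 1`.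
  · refine squeeze_zero_norm' ?_ (tendsto_inv_atTop_nhds_zero_nat (𝕜 := ℝ))
    filter_upwards [eventually_ge_atTop 1] with d hd
    have hd0 : (0 : ℝ) < d := Nat.cast_pos.mpr hd
    have key := agreeCount_mul_pow_le_of_not_isPlanar (K := Fin d)
      (by rw [Fintype.card_fin]; exact hd) h hcyc (fun t ht => absurd (Finset.mem_univ t) ht)
    rw [Fintype.card_fin, Finset.card_univ, Fintype.card_fin] at key
    have key' : (agreeCount (Fin d) α 1 : ℝ) * agreeCount (Fin d) α (finRotate p) * (d : ℝ) ^ p ≤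
        (d : ℝ) ^ (2 * p) := by exact_mod_cast key
    have key2 : (agreeCount (Fin d) α 1 : ℝ) * agreeCount (Fin d) α (finRotate p) ≤
        (d : ℝ) ^ p := by
      refine le_of_mul_le_mul_right (key'.trans_eq ?_) (pow_pos hd0 p)
      ring
    rw [norm_mul, norm_mul, norm_pow, norm_inv, Complex.norm_natCast, Complex.norm_natCast,
      Complex.norm_natCast, mul_comm (agreeCount (Fin d) α (finRotate p) : ℝ), inv_pow,
      inv_mul_le_iff₀ (pow_pos hd0 _), pow_succ, mul_assoc, mul_inv_cancel₀ hd0.ne', mul_one]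
    exact key2

theorem tendsto_integral_ntrace_pow {κ : Type*} [Fintype κ] [DecidableEq κ] [Nonempty κ] {m : ℕ}
    (hm : m ≠ 0) {φ : Matrix κ κ ℂ →ₗ[ℂ] Matrix κ κ ℂ} {c : ℕ → ℂ}
    (hφ : HasScalarPartialTraces (choiMatrix φ) c)
    {Ω : ℕ → Type*} [∀ d, MeasurableSpace (Ω d)] {P : ∀ d, Measure (Ω d)}
    {G : ∀ d, Ω d → Matrix (Fin d × κ) (Fin d × Fin m) ℂ}
    (hG : ∀ d, IsComplexGaussianMatrix (P d) (G d)) (p : ℕ) :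
    Tendsto (fun d => ∫ ω, ntrace (((m : ℂ) • blockModify φ (wishart (G d ω))) ^ (p + 1)) ∂(P d))
      atTop (𝓝 (∑ σ ∈ noncrossingPartitions (p + 1), ∏ V ∈ σ.parts, (m * c V.card))) := by
  classical
  have : NeZero m := ⟨hm⟩
  have hn : (Fintype.card κ : ℂ) ≠ 0 := Nat.cast_ne_zero.mpr Fintype.card_ne_zero
  have hval : ∀ d, ∫ ω, ntrace (((m : ℂ) • blockModify φ (wishart (G d ω))) ^ (p + 1)) ∂(P d) =
      ∑ α : Equiv.Perm (Fin (p + 1)), ((d : ℂ)⁻¹ ^ (p + 1 + 1) *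
        (agreeCount (Fin d) α (finRotate (p + 1)) * agreeCount (Fin d) α 1)) *
        ((Fintype.card κ : ℂ)⁻¹ * (agreeCount (Fin m) α 1 *
          twistedTrace (choiMatrix φ) α (finRotate (p + 1)) fun _ => 1)) := by
    intro d
    simp only [ntrace]
    rw [integral_const_mul, integral_trace_pow_smul_blockModify_wishart hm φ (hG d),
      Finset.mul_sum, Fintype.card_prod, Fintype.card_fin, Nat.cast_mul, mul_inv]
    exact Finset.sum_congr rfl fun α _ => by ring
  simp_rw [hval]
  have hlim : ∑ σ ∈ noncrossingPartitions (p + 1), ∏ V ∈ σ.parts, (m * c V.card) =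
      ∑ α : Equiv.Perm (Fin (p + 1)), (if IsPlanar α then 1 else 0) *
        ((Fintype.card κ : ℂ)⁻¹ * (agreeCount (Fin m) α 1 *
          twistedTrace (choiMatrix φ) α (finRotate (p + 1)) fun _ => 1)) := by
    rw [← sum_isPlanar_eq_sum_noncrossing fun V => (m : ℂ) * c V.card, Finset.sum_filter]
    refine Finset.sum_congr rfl fun α _ => ?_
    split_ifs with h
    · have hred := h.isReducible (isCyclicSuccOn_finRotate (p + 1))
        (fun t ht => absurd (Finset.mem_univ t) ht) Finset.univ_nonempty
      have hZ := hred.twistedTrace_eq hφ fun _ => 1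
      rw [Finset.card_univ, Fintype.card_fin] at hZ
      rw [hred.agreeCount_eq_prod, Finset.prod_mul_distrib, Fintype.card_fin, one_mul]
      -- With all exponents `1` and `S` everything, the accumulated exponents are the orbit sizes;
      -- the remaining factor `n` cancels the normalization of the trace.
      have hZ' : (twistedTrace (choiMatrix φ) α (finRotate (p + 1)) fun _ => 1) =
          Fintype.card κ * ∏ V ∈ orbits α, c V.card := by
        refine mul_right_cancel₀ (pow_ne_zero (p + 1) hn) (hZ.trans ?_)
        simp only [Finset.sum_const, smul_eq_mul, mul_one]
        ring
      rw [hZ']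
      field_simp
    · rw [zero_mul]
  rw [hlim]
  exact tendsto_finsetSum _ fun α _ => (tendsto_agreeCount_ratio α).mul_const _

theorem measureStarMoments_natCast_smul {ι : Type*} [Fintype ι] [DecidableEq ι]
    {A : Matrix ι ι ℂ} (hA : A.IsHermitian) {ρ : Measure ℂ} (hρ : IsLaw A ρ) (r : ℕ) {q : ℕ}
    (e : Fin q → StarExp) :
    measureStarMoments ((r : ℝ≥0∞) • ρ) q e = r * ntrace (A ^ q) := by
  have h : measureStarMoments ρ q e = ntrace (A ^ q) := by
    rw [hρ.moments_eq, matrixStarMoments, starWord_of_star_eq hA]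
  rw [← h, measureStarMoments, integral_smul_measure, ENNReal.toReal_natCast]
  simp [measureStarMoments]

theorem IsLaw.isCompoundFreePoisson {ι : Type*} [Fintype ι] [DecidableEq ι]
    {A : Matrix ι ι ℂ} {ρ : Measure ℂ} (hρ : IsLaw A ρ) (r : ℕ) :
    IsCompoundFreePoisson ((r : ℝ≥0∞) • ρ)
      (momentsOfCumulants (measureStarMoments ((r : ℝ≥0∞) • ρ))) := by
  obtain ⟨R, hR⟩ := hρ.bounded_support
  have := hρ.isProbabilityMeasure
  have : IsFiniteMeasure ((r : ℝ≥0∞) • ρ) := ρ.smul_finite (ENNReal.natCast_ne_top r)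
  exact isCompoundFreePoisson_momentsOfCumulants fun p e =>
    integrable_starWord_of_bounded (R := R) (Measure.ae_smul_measure hR _) e
theorem theorem6p3 (s N m : ℕ) (hN : 1 ≤ N) (hm : 1 ≤ m)
    (π : RowPartition s) (heven : π.IsEven) (hsymm : π.middleFlip = π)
    (hunital : IsUnitalModScalars (π.easyMap N))
    (hunital' : IsUnitalModScalars (π.upsideDown.easyMap N))
    {Ω : ℕ → Type*} [∀ d, MeasurableSpace (Ω d)]
    (P : ∀ d, Measure (Ω d)) [∀ d, IsProbabilityMeasure (P d)]
    (G : ∀ d, Ω d → Matrix (Fin d × (Fin s → Fin N)) (Fin d × Fin m) ℂ)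
    (hG : ∀ d, IsComplexGaussianMatrix (P d) (G d)) :
    ∃ ρ : Measure ℂ, IsLaw (choiMatrix (π.easyMap N)) ρ ∧
      ∃ L : StarDistribution, IsCompoundFreePoisson (((m * N ^ s : ℕ) : ℝ≥0∞) • ρ) L ∧
        ∀ (p : ℕ) (e : Fin p → StarExp),
          (∀ d, Integrable (fun ω => ntrace
            (starWord ((m : ℂ) • blockModify (π.easyMap N) (wishart (G d ω))) e)) (P d)) ∧
          Tendsto (fun d => randomMatrixStarMoments (P d)
              (fun ω => (m : ℂ) • blockModify (π.easyMap N) (wishart (G d ω))) p e)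
            atTop (𝓝 (L p e)) := by
  have hm0 : m ≠ 0 := by omega
  have : NeZero N := ⟨by omega⟩
  have hherm : (choiMatrix (π.easyMap N)).IsHermitian := isHermitian_choiMatrix_easyMap hsymm
  have hX : ∀ d ω, star ((m : ℂ) • blockModify (π.easyMap N) (wishart (G d ω))) =
      (m : ℂ) • blockModify (π.easyMap N) (wishart (G d ω)) := fun d ω =>
    isHermitian_smul_blockModify_wishart hm0 hherm (G d ω)
  obtain ⟨ρ, hρ⟩ := exists_isLaw_of_isHermitian hherm
  refine ⟨ρ, hρ, _, hρ.isCompoundFreePoisson _, fun p e => ?_⟩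
  simp only [randomMatrixStarMoments, starWord_of_star_eq (hX _ _)]
  cases p with
  | zero =>
    simp only [pow_zero]
    refine ⟨fun d => integrable_const _, ?_⟩
    rw [momentsOfCumulants_zero_length]
    refine tendsto_const_nhds.congr' ?_
    -- For `d = 0` the matrix is empty and its normalized trace is `0`, so the value `1` holds only
    -- from `d = 1` on.
    filter_upwards [eventually_ge_atTop 1] with d hd
    have hd0 : (d : ℂ) ≠ 0 := Nat.cast_ne_zero.mpr (by omega)
    have hN0 : (N : ℂ) ≠ 0 := NeZero.ne _
    simp only [ntrace, Matrix.trace_one, Fintype.card_prod, Fintype.card_fun, Fintype.card_fin,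
      Nat.cast_mul, Nat.cast_pow, integral_const, probReal_univ, one_smul]
    field_simp
  | succ p =>
    refine ⟨fun d => (integrable_trace_pow_smul_blockModify_wishart hm0 _ (hG d) p).const_mul _, ?_⟩
    have key := tendsto_integral_ntrace_pow hm0
      (hasScalarPartialTraces_choiMatrix hN heven hunital) hG p
    convert key using 2
    refine Finset.sum_congr rfl fun σ _ => Finset.prod_congr rfl fun V _ => ?_
    -- The constants agree because the normalized trace of `Λ ^ q` divides by `n²` and the partial
    -- trace scalar by `n`: `mn` times the former is `m` times the latter.
    rw [measureStarMoments_natCast_smul hherm hρ]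
    have hN0 : (N : ℂ) ≠ 0 := NeZero.ne _
    simp only [ntrace, Fintype.card_prod, Fintype.card_fun, Fintype.card_fin]
    push_cast
    field_simp
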